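/- **Setting.** Two players $i=1,2$ have types $x_t^i\in\mathbb R^{n_i}$ and actions $u_t^i\in\mathbb R^{m_i}$, $t=1,\dots,T$, with $x_{t+1}^i=A_t^ix_t^i+B_t^iu_t+w_t^i$, $u_t=(u_t^1,u_t^2)$, $B_t^i=[B_{1,t}^i\ B_{2,t}^i]$, independent noises $w_t^i\sim N(0,Q^i)$, $Q^i\succeq0$, and stage costs $R^i(x,u)=u^{\mathsf T}T^iu+x^{\mathsf T}P^ix+2u^{\mathsf T}S^ix$ with $T^i,P^i$ symmetric. Write $\mathbf R^i=\begin{bmatrix}T^i&S^i\\S^{i\mathsf T}&P^i\end{bmatrix}$, $\mathrm{quad}(A;b)=b^{\mathsf T}Ab$, and $-i$ for the player other than $i$. All inverses below are Moore–Penrose pseudo-inverses. *Belief update.* For a belief $\pi^i$ on $x_t^i$, a partial strategy $\gamma^i$ (a kernel from types to actions) and a joint action $u$, say that $u^i$ is on path if it lies in the support of the law of player $i$'s action under $\pi^i,\gamma^i$. If $u^i$ is on path, $\bar F(\pi^i,\gamma^i,u)$ is the law of the next type given by Bayes' rule, i.e. the weak limit, as $\varepsilon\to0^+$, of the law of $A_t^iX+B_t^iu+w^i$,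 where $w^i\sim N(0,Q^i)$ is independent of $X$ and $X$ has law $\pi^i$ reweighted by $x\mapsto\gamma^i(\mathrm{ball}(u^i,\varepsilon)\mid x)$ and normalized. If $u^i$ is off path, consider two rules: (P) no learning: $\bar F$ is the law of $A_t^iX+B_t^iu+w^i$ with $X\sim\pi^i$; (N) learn from the on-path action $v$ nearest to $u^i$: the Bayes weights use $\gamma^i(\mathrm{ball}(v,\varepsilon)\mid x)$, while the drift uses $u$. Put $F(\pi,\gamma,u)=(\bar F(\pi^1,\gamma^1,u),\bar F(\pi^2,\gamma^2,u))$. *Backward recursion.* On given classes of pairs of beliefs, one for each time, a solution consists of $\theta_t[\pi]=\tilde\gamma_t=(\tilde\gamma_t^1,\tilde\gamma_t^2)$ and real-valued $V_t^i(\pi,x^i)$ such that $V_{T+1}^i=0$ and, for $t=T,\dots,1$, each $\pi$ in the class at time $t$, each $i$ and $x^i$: $\tilde\gamma_t^i(\cdot|x^i)$ minimizes, over all probability measures $\nu$ on $\mathbb R^{m_i}$, $$\mathbb E\bigl[R^i(X_t,U_t)+V_{t+1}^i(F(\pi,\tilde\gamma_t,U_t),X_{t+1}^i)\,\big|\,X_t^i=x^i\bigr],\quad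 X_t^{-i}\sim\pi^{-i},\ U_t^i\sim\nu,\ U_t^{-i}\sim\tilde\gamma_t^{-i}(\cdot|X_t^{-i}),$$ where $U_t^i$ is independent of $(X_t^{-i},U_t^{-i})$ (the value may be $+\infty$ for some $\nu$); $V_t^i(\pi,x^i)$ is the (finite) minimum; and, for all $u$, $F(\pi,\tilde\gamma_t,u)$ is well defined and lies in the class at time $t+1$. *Matrices.* For $\Sigma=(\Sigma^1,\Sigma^2)$ and $L=(L^1,L^2)$ with $L^i\in\mathbb R^{m_i\times n_i}$ let $G^i=\Sigma^iL^{i\mathsf T}(L^i\Sigma^iL^{i\mathsf T})^{-1}$ and $\phi_s(\Sigma,L)^i=A_t^i(I-G^iL^i)\Sigma^i(I-G^iL^i)^{\mathsf T}A_t^{i\mathsf T}+Q^i$. Let $e^i=(x^i,\hat x^1,\hat x^2)$ and, with block rows indexed by $(u^1,u^2,x^1,x^2,x_{t+1}^i,\hat x_{t+1}^1,\hat x_{t+1}^2)$, let (index $t$ suppressed) $$D^1=[D^{u1}\ D^{e1}]=\begin{bmatrix}I&0&0&0\\0&0&0&L^2\\0&I&0&0\\0&0&0&I\\B_1^1&A^1&0&B_2^1L^2\\A^1G^1+B_1^1&0&A^1(I-G^1L^1)&B_2^1L^2\\B_1^2&0&0&A^2+B_2^2L^2\end{bmatrix},\quad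 C^1=\begin{bmatrix}0&0\\0&I\\0&0\\0&0\\0&B_2^1\\-A^1G^1&B_2^1\\0&B_2^2\end{bmatrix},\quad J^1=\begin{bmatrix}0\\L^2\\0\\I\\B_2^1L^2\\B_2^1L^2\\(B_2^2+A^2G^2)L^2\end{bmatrix},$$ the columns of $D^1$ being for $u^1,x^1,\hat x^1,\hat x^2$; write $[D^{e1}]_1$, $[D^{e1}]_{23}$ for its $x^1$ column and its $(\hat x^1,\hat x^2)$ columns. $D^2,C^2,J^2$ are obtained by exchanging the roles of the players (the column order in $D^2$ is $u^2,x^2,\hat x^1,\hat x^2$). Let $\tilde L_t:\Sigma\mapsto\tilde L_t(\Sigma)$, $t=1,\dots,T$, be given. Define recursively $V_{T+1}^i(\Sigma)=0$, $\rho_{T+1}^i(\Sigma)=0$ and, with $\Sigma_+=\phi_s(\Sigma,\tilde L_t(\Sigma))$ and all of $D,C,J$ evaluated at $L=\tilde L_t(\Sigma)$, $$\bar V_t^i=\begin{bmatrix}\mathbf R^i&0\\0&V_{t+1}^i(\Sigma_+)\end{bmatrix},\qquad \tilde M_t=-K_t^{-1}N_t,\qquad V_t^i(\Sigma)=\tilde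 F_t^{i\mathsf T}\bar V_t^i\tilde F_t^i,$$ $$K_t=\begin{bmatrix}D^{u1\mathsf T}\bar V^1D^{u1}&0\\0&D^{u2\mathsf T}\bar V^2D^{u2}\end{bmatrix}+\begin{bmatrix}D^{u1\mathsf T}\bar V^1C^1\\D^{u2\mathsf T}\bar V^2C^2\end{bmatrix},\quad N_t=\begin{bmatrix}D^{u1\mathsf T}\bar V^1[D^{e1}]_{23}\\D^{u2\mathsf T}\bar V^2[D^{e2}]_{23}\end{bmatrix},\quad \tilde F_t^i=\begin{bmatrix}D^{ui}\tilde L_t^i&D^{ui}\tilde M_t^i+C^i\tilde M_t\end{bmatrix}+D^{ei},$$ $$\rho_t^i(\Sigma)=\mathrm{tr}\bigl(\Sigma^{-i}\,\mathrm{quad}(\bar V_t^i;J^i)\bigr)+\mathrm{tr}\bigl(Q^iV_{11,t+1}^i(\Sigma_+)\bigr)+\rho_{t+1}^i(\Sigma_+),$$ where $\Sigma^{-i}$ is the covariance of the other player, $V_{11,t+1}^i$ is the $x^i$–$x^i$ block of $V_{t+1}^i$, and $\tilde M_t^i$ is the $i$-th block row of $\tilde M_t$. **Theorem.** Let $\mathcal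 S_t$ ($t=1,\dots,T+1$) be sets of pairs $\Sigma=(\Sigma^1,\Sigma^2)$ of positive semidefinite covariance matrices (for instance, all such pairs), and suppose that, for $t\le T$ and $\Sigma\in\mathcal S_t$: 1. $\phi_s(\Sigma,\tilde L_t(\Sigma))\in\mathcal S_{t+1}$; 2. $\tilde L_t=\tilde L_t(\Sigma)$ solves the algebraic fixed point equation $(D^{ui\mathsf T}\bar V_t^iD^{ui})\tilde L_t^i=-D^{ui\mathsf T}\bar V_t^i[D^{ei}]_1$, $i=1,2$; 3. $D^{ui\mathsf T}\bar V_t^iD^{ui}$ is positive definite for $i=1,2$ (this hypothesis may be replaced by: $\mathbf R^1,\mathbf R^2$ are positive definite); 4. the linear equation $K_tM=-N_t$ is solvable (e.g. $K_t$ is invertible). Then there are $\theta$ and $V$ that solve the backward recursion, with the off-path rule (N), on the classes of Gaussian beliefs $\pi=(N(\hat x^1,\Sigma^1),N(\hat x^2,\Sigma^2))$, $\hat x^i\in\mathbb R^{n_i}$ arbitrary, $\Sigma\in\mathcal S_t$, and for such $\pi$ $$\tilde\gamma_t^i(u|x^i)=\delta\bigl(u-\tilde L_t^i(\Sigma)x^i-\tilde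 m_t^i\bigr),\quad \tilde m_t=\tilde M_t(\Sigma)\hat x\quad(1\le t\le T),$$ $$V_t^i(\pi,x^i)=\mathrm{quad}\bigl(V_t^i(\Sigma);e^i\bigr)+\rho_t^i(\Sigma)\quad(1\le t\le T+1).$$ If moreover each $\tilde L_t^i(\Sigma)\Sigma^i\tilde L_t^i(\Sigma)^{\mathsf T}$ ($\Sigma\in\mathcal S_t$, $t\le T$) is invertible or zero, then the same $\theta,V$ also solve the backward recursion with the off-path rule (P). -/

import Mathlib

open MeasureTheory ProbabilityTheory Filter Topology Matrix
open scoped BoundedContinuousFunction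

noncomputable section

namespace LQG

/-! ### Moore–Penrose pseudo-inverse -/

/-- The four Penrose equations: `X` is the Moore–Penrose pseudo-inverse of the real matrix `M`. -/
def IsPinv {a b : Type*} [Fintype a] [Fintype b] (M : Matrix a b ℝ) (X : Matrix b a ℝ) : Prop :=
  M * X * M = M ∧ X * M * X = X ∧ (M * X)ᵀ = M * X ∧ (X * M)ᵀ = X * M

theorem exists_isPinv_aux {b : Type*} [Fintype b] [DecidableEq b] (H : Matrix b b ℝ) (hH : H.IsHermitian) :
    ∃ X : Matrix b b ℝ, Xᵀ = X ∧ H * X * H = H ∧ X * H * X = X ∧ X * H = H * X := by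
  have hs : IsSelfAdjoint H := hH
  have hc : ∀ f : ℝ → ℝ, ContinuousOn f (spectrum ℝ H) := fun f =>
    (Matrix.finite_real_spectrum (A := H)).continuousOn f
  have e : cfc (fun x : ℝ => x) H = H := cfc_id' ℝ H
  refine ⟨cfc (fun x : ℝ => x⁻¹) H, ?_, ?_, ?_, ?_⟩
  · have : IsSelfAdjoint (cfc (fun x : ℝ => x⁻¹) H) := cfc_predicate _ _
    simpa [IsSelfAdjoint, star_eq_conjTranspose, conjTranspose_eq_transpose_of_trivial] using this
  · nth_rw 1 3 [← e]
    rw [← cfc_mul _ _ H (hc _) (hc _), ← cfc_mul _ _ H (hc _) (hc _)]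
    conv_rhs => rw [← e]
    exact cfc_congr fun x _ => by simp
  · have h := cfc_mul (fun x : ℝ => x⁻¹ * x) (fun x : ℝ => x⁻¹) H (hc _) (hc _)
    rw [cfc_mul (fun x : ℝ => x⁻¹) (fun x : ℝ => x) H (hc _) (hc _), e] at h
    rw [← h]
    refine cfc_congr fun x _ => ?_
    by_cases hx : x = 0
    · simp [hx]
    · field_simp
  · have h := (cfc_commute_cfc (fun x : ℝ => x⁻¹) (fun x : ℝ => x) H).eq
    rwa [e] at h

theorem exists_isPinv {a b : Type*} [Fintype a] [Fintype b]
    (M : Matrix a b ℝ) : ∃ X, IsPinv M X := by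
  classical
  obtain ⟨X, hX, h1, h2, h3⟩ := exists_isPinv_aux (Mᵀ * M) (by
    simpa [conjTranspose_eq_transpose_of_trivial] using isHermitian_conjTranspose_mul_self M)
  have key : M * X * (Mᵀ * M) = M := by
    rw [← sub_eq_zero, ← conjTranspose_mul_self_eq_zero, conjTranspose_eq_transpose_of_trivial]
    simp only [transpose_sub, transpose_mul, transpose_transpose, hX, Matrix.sub_mul, Matrix.mul_sub]
    have e1 : Mᵀ * M * (X * Mᵀ) * (M * X * (Mᵀ * M)) = Mᵀ * M := by
      calc _ = ((Mᵀ * M) * X * (Mᵀ * M)) * X * (Mᵀ * M) := by simp only [Matrix.mul_assoc]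
        _ = _ := by rw [h1, h1]
    have e2 : Mᵀ * (M * X * (Mᵀ * M)) = Mᵀ * M := by
      calc _ = ((Mᵀ * M) * X * (Mᵀ * M)) := by simp only [Matrix.mul_assoc]
        _ = _ := h1
    have e3 : Mᵀ * M * (X * Mᵀ) * M = Mᵀ * M := by
      calc _ = ((Mᵀ * M) * X * (Mᵀ * M)) := by simp only [Matrix.mul_assoc]
        _ = _ := h1
    rw [e1, e2, e3]; simp
  refine ⟨X * Mᵀ, ?_, ?_, ?_, ?_⟩
  · simpa only [Matrix.mul_assoc] using key
  · calc _ = (X * (Mᵀ * M) * X) * Mᵀ := by simp only [Matrix.mul_assoc]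
      _ = _ := by rw [h2]
  · simp [transpose_mul, hX, Matrix.mul_assoc]
  · simp only [transpose_mul, transpose_transpose, hX]
    rw [← Matrix.mul_assoc, ← h3, Matrix.mul_assoc]

theorem IsPinv.unique {a b : Type*} [Fintype a] [Fintype b] {M : Matrix a b ℝ}
    {X Y : Matrix b a ℝ} (hX : IsPinv M X) (hY : IsPinv M Y) : X = Y := by
  obtain ⟨x1, x2, x3, x4⟩ := hX
  obtain ⟨y1, y2, y3, y4⟩ := hY
  have hL : M * X = M * Y := by
    calc M * X = M * Y * M * X := by rw [y1]
      _ = (M * Y)ᵀ * (M * X)ᵀ := by rw [y3, x3]; simp only [Matrix.mul_assoc]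
      _ = (M * X * M * Y)ᵀ := by rw [← transpose_mul]; simp only [Matrix.mul_assoc]
      _ = M * Y := by rw [x1, y3]
  have hR : X * M = Y * M := by
    calc X * M = X * (M * Y * M) := by rw [y1]
      _ = (X * M)ᵀ * (Y * M)ᵀ := by rw [y4, x4]; simp only [Matrix.mul_assoc]
      _ = (Y * (M * X * M))ᵀ := by rw [← transpose_mul]; simp only [Matrix.mul_assoc]
      _ = Y * M := by rw [x1, y4]
  calc X = X * M * X := x2.symm
    _ = Y * M * X := by rw [hR]
    _ = Y * (M * X) := Matrix.mul_assoc _ _ _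
    _ = Y * (M * Y) := by rw [hL]
    _ = Y := by rw [← Matrix.mul_assoc, y2]

/-- The Moore–Penrose pseudo-inverse of a real matrix. -/
def pinv {a b : Type*} [Fintype a] [Fintype b] (M : Matrix a b ℝ) : Matrix b a ℝ :=
  (exists_isPinv M).choose

/-! ### The game -/

/-- Index set of a joint vector `(v^1, v^2)` whose components have dimensions `d 0`, `d 1`. -/
abbrev Idx (d : Fin 2 → ℕ) : Type := Σ i : Fin 2, Fin (d i)

/-- The component space `ℝ^{d i}`: types of player `i` for `d = n`, actions for `d = m`. -/
abbrev Sp (d : Fin 2 → ℕ) (i : Fin 2) : Type := EuclideanSpace ℝ (Fin (d i))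

/-- The player other than `i`. -/
def other (i : Fin 2) : Fin 2 := 1 - i

/-- Block column that puts a vector of player `i` at its place in a joint vector, and puts zero in
the place of the other player. -/
def inj (d : Fin 2 → ℕ) (i : Fin 2) : Matrix (Idx d) (Fin (d i)) ℝ :=
  Matrix.of fun p a => if p = ⟨i, a⟩ then 1 else 0

/-- Block diagonal projection that keeps the part of player `i` of a joint vector. -/
def own (d : Fin 2 → ℕ) (i : Fin 2) : Matrix (Idx d) (Idx d) ℝ :=
  Matrix.diagonal fun p => if p.1 = i then 1 else 0

/-- Block diagonal projection that keeps the part of the other player of a joint vector. -/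
def oth (d : Fin 2 → ℕ) (i : Fin 2) : Matrix (Idx d) (Idx d) ℝ :=
  Matrix.diagonal fun p => if p.1 = i then 0 else 1

/-- The joint vector `(v^1, v^2)`. -/
def flat {d : Fin 2 → ℕ} (v : ∀ i, Sp d i) : Idx d → ℝ := fun p => v p.1 p.2

/-- The part of player `i` of a joint vector. -/
def comp {d : Fin 2 → ℕ} (v : Idx d → ℝ) (i : Fin 2) : Sp d i :=
  WithLp.toLp 2 fun a => v ⟨i, a⟩

/-- The joint vector with part `a` for player `i` and part `b` for the other player. -/
def assemble {d : Fin 2 → ℕ} (i : Fin 2) (a : Sp d i) (b : Sp d (other i)) : Idx d → ℝ :=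
  inj d i *ᵥ a.ofLp + inj d (other i) *ᵥ b.ofLp

/-- `quad(M; v) = vᵀ M v`. -/
def quad {a : Type*} [Fintype a] (M : Matrix a a ℝ) (v : a → ℝ) : ℝ := v ⬝ᵥ (M *ᵥ v)

/-- A two-player linear-quadratic-Gaussian game with private types. Player `i` has types in
`ℝ^{n i}` and actions in `ℝ^{m i}`. Types evolve as `x_{t+1}^i = A_t^i x_t^i + B_t^i u_t + w_t^i`
with `w_t^i ∼ N(0, Q^i)`; the matrix `B_t^i` acts on the joint action `u_t = (u_t^1, u_t^2)`. -/
structure Game (n m : Fin 2 → ℕ) where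
  /-- the horizon; decision times are `1, …, horizon` -/
  horizon : ℕ
  A : ℕ → ∀ i : Fin 2, Matrix (Fin (n i)) (Fin (n i)) ℝ
  B : ℕ → ∀ i : Fin 2, Matrix (Fin (n i)) (Idx m) ℝ
  Q : ∀ i : Fin 2, Matrix (Fin (n i)) (Fin (n i)) ℝ
  /-- the cost matrices `T^i` -/
  costT : Fin 2 → Matrix (Idx m) (Idx m) ℝ
  /-- the cost matrices `S^i` -/
  costS : Fin 2 → Matrix (Idx m) (Idx n) ℝ
  /-- the cost matrices `P^i` -/
  costP : Fin 2 → Matrix (Idx n) (Idx n) ℝ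
  Q_posSemidef : ∀ i, (Q i).PosSemidef
  costT_symm : ∀ i, (costT i).IsSymm
  costP_symm : ∀ i, (costP i).IsSymm

/-- A pair of covariance matrices, one for each player. -/
abbrev Cov (n : Fin 2 → ℕ) : Type := ∀ i : Fin 2, Matrix (Fin (n i)) (Fin (n i)) ℝ

/-- A pair of gain matrices `(L^1, L^2)`. -/
abbrev Gain (n m : Fin 2 → ℕ) : Type := ∀ i : Fin 2, Matrix (Fin (m i)) (Fin (n i)) ℝ

/-- A pair of beliefs, one on the current type of each player. -/
abbrev Belief (n : Fin 2 → ℕ) : Type := ∀ i : Fin 2, Measure (Sp n i)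

/-- A pair of partial strategies `γ^i : ℝ^{n i} → P(ℝ^{m i})`. -/
abbrev Partial (n m : Fin 2 → ℕ) : Type := ∀ i : Fin 2, Kernel (Sp n i) (Sp m i)

variable {n m : Fin 2 → ℕ}

namespace Game

variable (g : Game n m)

/-- The instantaneous cost matrix `R^i`. -/
def costR (i : Fin 2) : Matrix (Idx m ⊕ Idx n) (Idx m ⊕ Idx n) ℝ :=
  Matrix.fromBlocks (g.costT i) (g.costS i) (g.costS i)ᵀ (g.costP i)

/-- The instantaneous cost `R^i(x, u) = uᵀ T^i u + xᵀ P^i x + 2 uᵀ S^i x`. -/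
def stageCost (i : Fin 2) (x : Idx n → ℝ) (u : Idx m → ℝ) : ℝ :=
  quad (g.costT i) u + quad (g.costP i) x + 2 * (u ⬝ᵥ (g.costS i *ᵥ x))

/-- The law `N(0, Q^i)` of the noise. -/
def noise (i : Fin 2) : Measure (Sp n i) := multivariateGaussian 0 (g.Q i)

/-- The next type `A_t^i x + B_t^i u + w` of player `i`; with `w ∼ N(0, Q^i)` its law is the
transition kernel `Q^i(· | x, u)`. -/
def dyn (t : ℕ) (i : Fin 2) (x : Sp n i) (u : Idx m → ℝ) (w : Sp n i) : Sp n i :=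
  WithLp.toLp 2 (g.A t i *ᵥ x.ofLp + g.B t i *ᵥ u + w.ofLp)

end Game

/-! ### The belief update -/

/-- The mass `∫ γ(ball(v, ε) | x) π(dx)` that `π` and `γ` give to actions near `v`. Divided by the
volume of the ball, it tends to the density `∫ π(x) γ(v | x) dx` where there is one. -/
def actionMass {i : Fin 2} (π : Measure (Sp n i)) (γ : Kernel (Sp n i) (Sp m i)) (v : Sp m i)
    (ε : ℝ) : ℝ :=
  ∫ x, (γ x).real (Metric.ball v ε) ∂π

/-- The action `v` lies in the support of the law of the action under `π` and `γ`: this is the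
rigorous form of a non-zero Bayes denominator, valid also when `γ` is a Dirac kernel. -/
def OnPath {i : Fin 2} (π : Measure (Sp n i)) (γ : Kernel (Sp n i) (Sp m i)) (v : Sp m i) : Prop :=
  ∀ ε : ℝ, 0 < ε → 0 < actionMass π γ v ε

namespace Game

variable (g : Game n m)

/-- `π'` is the Bayes update
`π'(dx') = ∫ π(dx) γ(v | x) Q^i(dx' | x, u) / ∫ π(dx) γ(v | x)`
where the player's own action in the Bayes weights is observed to be `v`. The value `γ(v | x)` is
approximated by `γ(ball(v, ε) | x)` and `ε → 0+`, in the sense of weak convergence. -/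
def IsBayes (t : ℕ) (i : Fin 2) (π : Measure (Sp n i)) (γ : Kernel (Sp n i) (Sp m i))
    (v : Sp m i) (u : Idx m → ℝ) (π' : Measure (Sp n i)) : Prop :=
  OnPath π γ v ∧
  ∀ f : Sp n i →ᵇ ℝ,
    Tendsto
      (fun ε : ℝ =>
        (∫ x, (γ x).real (Metric.ball v ε) * (∫ w, f (g.dyn t i x u w) ∂(g.noise i)) ∂π)
          / actionMass π γ v ε)
      (𝓝[>] 0) (𝓝 (∫ y, f y ∂π'))

/-- The update without learning: the law of the next type if the current one has law `π`. -/
def predict (t : ℕ) (i : Fin 2) (π : Measure (Sp n i)) (u : Idx m → ℝ) : Measure (Sp n i) :=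
  (π.prod (g.noise i)).map fun p => g.dyn t i p.1 u p.2

/-- The type of a belief update rule, as a relation between the current belief on player `i`, the
partial strategy of player `i`, the joint action, and the next belief on player `i`. -/
abbrev UpdateRule (n m : Fin 2 → ℕ) : Type :=
  ℕ → ∀ i : Fin 2, Measure (Sp n i) → Kernel (Sp n i) (Sp m i) → (Idx m → ℝ) →
    Measure (Sp n i) → Prop

/-- Bayes' rule where the denominator does not vanish, and the update without learning after an
action of player `i` for which it vanishes. -/
def bayesOrPredict : UpdateRule n m := fun t i π γ u π' =>
  (OnPath π γ (comp u i) ∧ g.IsBayes t i π γ (comp u i) u π') ∨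
    (¬ OnPath π γ (comp u i) ∧ π' = g.predict t i π u)

/-- Bayes' rule where the denominator does not vanish; after an action `u^i` for which it vanishes,
learn from the action in the support that is nearest to `u^i`. (If `u^i` is in the support, the
nearest action is `u^i` itself.) -/
def bayesOrNearest : UpdateRule n m := fun t i π γ u π' =>
  ∃ v : Sp m i, OnPath π γ v ∧ (∀ v', OnPath π γ v' → dist (comp u i) v ≤ dist (comp u i) v') ∧
    g.IsBayes t i π γ v u π'

end Game

open Classical in
/-- The updated belief `F̄(π, γ, u)` under an update rule. -/
def nextBelief (upd : Game.UpdateRule n m) (t : ℕ) (i : Fin 2) (π : Measure (Sp n i))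
    (γ : Kernel (Sp n i) (Sp m i)) (u : Idx m → ℝ) : Measure (Sp n i) :=
  if h : ∃ π' : Measure (Sp n i), IsProbabilityMeasure π' ∧ upd t i π γ u π' then h.choose else 0

/-- The updated pair of beliefs `F(π, γ, u)`. -/
def nextBeliefs (upd : Game.UpdateRule n m) (t : ℕ) (π : Belief n) (γ : Partial n m)
    (u : Idx m → ℝ) : Belief n :=
  fun i => nextBelief upd t i (π i) (γ i) u

/-! ### The backward recursion -/

open Classical in
/-- Extended expectation: the integral of an integrable function, `+∞` if only the negative part is
integrable, and `-∞` otherwise. -/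
def extExp {Ω : Type*} [MeasurableSpace Ω] (μ : Measure Ω) (f : Ω → ℝ) : EReal :=
  if Integrable f μ then ((∫ ω, f ω ∂μ : ℝ) : EReal)
  else if Integrable (fun ω => max (-f ω) 0) μ then ⊤ else ⊥

namespace Game

variable (g : Game n m)

/-- The cost-to-go of player `i` at time `t` with type `x`, if the beliefs are `π`, player `i` draws
her action from `ν`, the other player uses `γ^{-i}`, and beliefs are updated with `γ`:
`E[R^i(X_t, U_t) + V_{t+1}^i(F(π, γ, U_t), X_{t+1}^i) | π, x]`.
The underlying random variables are `((x^{-i}, u^{-i}), u^i), w^i`. -/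
def costToGo (upd : UpdateRule n m)
    (Vnext : ∀ i : Fin 2, Belief n → Sp n i → ℝ)
    (t : ℕ) (π : Belief n) (γ : Partial n m) (i : Fin 2) (x : Sp n i)
    (ν : Measure (Sp m i)) : EReal :=
  extExp ((((π (other i)) ⊗ₘ (γ (other i))).prod ν).prod (g.noise i))
    (fun ω =>
      let X : Idx n → ℝ := assemble i x ω.1.1.1
      let U : Idx m → ℝ := assemble i ω.1.2 ω.1.1.2
      g.stageCost i X U + Vnext i (nextBeliefs upd t π γ U) (g.dyn t i x U ω.2))

/-- `(θ, V)` solves the backward recursion on the classes of beliefs `𝓑 t`: `V_{T+1} = 0`, and at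
each time and each pair of beliefs in the class, the pair of partial strategies `θ_t[π]` is a
solution of the fixed point equation, `V_t` is the resulting cost, and all updated beliefs stay in
the class. -/
structure IsBackwardSolution (upd : UpdateRule n m) (𝓑 : ℕ → Set (Belief n))
    (θ : ℕ → Belief n → Partial n m)
    (V : ℕ → ∀ i : Fin 2, Belief n → Sp n i → ℝ) : Prop where
  terminal : ∀ (i : Fin 2) (π : Belief n) (x : Sp n i), V (g.horizon + 1) i π x = 0
  markov : ∀ t, 1 ≤ t → t ≤ g.horizon → ∀ π ∈ 𝓑 t, ∀ i, IsMarkovKernel (θ t π i)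
  closed : ∀ t, 1 ≤ t → t ≤ g.horizon → ∀ π ∈ 𝓑 t, ∀ u : Idx m → ℝ,
    (∀ i, upd t i (π i) (θ t π i) u (nextBeliefs upd t π (θ t π) u i)) ∧
      nextBeliefs upd t π (θ t π) u ∈ 𝓑 (t + 1)
  fixedPoint : ∀ t, 1 ≤ t → t ≤ g.horizon → ∀ π ∈ 𝓑 t, ∀ (i : Fin 2) (x : Sp n i)
    (ν : Measure (Sp m i)), IsProbabilityMeasure ν →
      g.costToGo upd (V (t + 1)) t π (θ t π) i x (θ t π i x) ≤
        g.costToGo upd (V (t + 1)) t π (θ t π) i x ν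
  value : ∀ t, 1 ≤ t → t ≤ g.horizon → ∀ π ∈ 𝓑 t, ∀ (i : Fin 2) (x : Sp n i),
    ((V t i π x : ℝ) : EReal) = g.costToGo upd (V (t + 1)) t π (θ t π) i x (θ t π i x)

end Game

/-- The pair of Gaussian beliefs `N(x̂^i, Σ^i)`. -/
def gaussBelief (xhat : ∀ i, Sp n i) (Sg : Cov n) : Belief n :=
  fun i => multivariateGaussian (xhat i) (Sg i)

/-- The pairs of Gaussian beliefs at time `t` whose covariances lie in `𝒮 t`. -/
def gaussBeliefs (𝒮 : ℕ → Set (Cov n)) (t : ℕ) : Set (Belief n) :=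
  {π | ∃ (xhat : ∀ i, Sp n i) (Sg : Cov n), Sg ∈ 𝒮 t ∧ π = gaussBelief xhat Sg}

/-! ### The matrices of the linear solution -/

/-- `G^i = Σ^i L^iᵀ (L^i Σ^i L^iᵀ)⁻¹`, with the pseudo-inverse. -/
def gainG (Sg : Cov n) (L : Gain n m) (i : Fin 2) : Matrix (Fin (n i)) (Fin (m i)) ℝ :=
  Sg i * (L i)ᵀ * pinv (L i * Sg i * (L i)ᵀ)

/-- Index set of `e^i = (x^i, x̂^1, x̂^2)`. -/
abbrev EIdx (n : Fin 2 → ℕ) (i : Fin 2) : Type := Fin (n i) ⊕ Idx n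

/-- Index set of `y^i = (u^1, u^2, x^1, x^2, x_{t+1}^i, x̂_{t+1}^1, x̂_{t+1}^2)`. -/
abbrev YIdx (n m : Fin 2 → ℕ) (i : Fin 2) : Type := (Idx m ⊕ Idx n) ⊕ EIdx n i

/-- The vector `e^i = (x^i, x̂^1, x̂^2)`. -/
def evec (i : Fin 2) (x : Sp n i) (xhat : ∀ j, Sp n j) : EIdx n i → ℝ :=
  Sum.elim x.ofLp (flat xhat)

namespace Game

variable (g : Game n m)

/-- The covariance update
`φ_s(Σ, L)^i = A_t^i (I - G^i L^i) Σ^i (I - G^i L^i)ᵀ A_t^iᵀ + Q^i`. -/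
def phiS (t : ℕ) (Sg : Cov n) (L : Gain n m) : Cov n := fun i =>
  g.A t i * (1 - gainG Sg L i * L i) * Sg i * (1 - gainG Sg L i * L i)ᵀ * (g.A t i)ᵀ + g.Q i

/-- `B_t`, with rows `B_t^1` and `B_t^2`. -/
def fullB (t : ℕ) : Matrix (Idx n) (Idx m) ℝ := Matrix.of fun p q => g.B t p.1 p.2 q

/-- The block diagonal matrix of `A_t^1 G^1` and `A_t^2 G^2`. -/
def fullAG (t : ℕ) (Sg : Cov n) (L : Gain n m) : Matrix (Idx n) (Idx m) ℝ :=
  Matrix.blockDiagonal' fun i => g.A t i * gainG Sg L i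

/-- The column of `D_t^i` for `u^i`. -/
def Du (t : ℕ) (Sg : Cov n) (L : Gain n m) (i : Fin 2) : Matrix (YIdx n m i) (Fin (m i)) ℝ :=
  Matrix.fromRows
    (Matrix.fromRows (inj m i) 0)
    (Matrix.fromRows (g.B t i * inj m i) ((g.fullAG t Sg L + g.fullB t) * inj m i))

/-- The column of `D_t^i` for `x^i`. -/
def Dx (t : ℕ) (i : Fin 2) : Matrix (YIdx n m i) (Fin (n i)) ℝ :=
  Matrix.fromRows
    (Matrix.fromRows 0 (inj n i))
    (Matrix.fromRows (g.A t i) 0)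

/-- The two columns of `D_t^i` for `x̂ = (x̂^1, x̂^2)`. -/
def Dxhat (t : ℕ) (Sg : Cov n) (L : Gain n m) (i : Fin 2) : Matrix (YIdx n m i) (Idx n) ℝ :=
  Matrix.fromRows
    (Matrix.fromRows (oth m i * Matrix.blockDiagonal' L) (oth n i))
    (Matrix.fromRows (g.B t i * oth m i * Matrix.blockDiagonal' L)
      (Matrix.blockDiagonal' (g.A t) + g.fullB t * oth m i * Matrix.blockDiagonal' L
        - g.fullAG t Sg L * own m i * Matrix.blockDiagonal' L))

/-- The matrix `C_t^i`, which multiplies `(m^1, m^2)`. -/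
def Cm (t : ℕ) (Sg : Cov n) (L : Gain n m) (i : Fin 2) : Matrix (YIdx n m i) (Idx m) ℝ :=
  Matrix.fromRows
    (Matrix.fromRows (oth m i) 0)
    (Matrix.fromRows (g.B t i * oth m i)
      (g.fullB t * oth m i - g.fullAG t Sg L * own m i))

/-- The matrix `J_t^i`, which multiplies `x^{-i} - x̂^{-i}`. -/
def Jm (t : ℕ) (Sg : Cov n) (L : Gain n m) (i : Fin 2) :
    Matrix (YIdx n m i) (Fin (n (other i))) ℝ :=
  Matrix.fromRows
    (Matrix.fromRows (inj m (other i) * L (other i)) (inj n (other i)))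
    (Matrix.fromRows (g.B t i * inj m (other i) * L (other i))
      ((g.fullB t + g.fullAG t Sg L) * inj m (other i) * L (other i)))

/-- `V̄^i`: block diagonal with blocks `R^i` and the next value matrix `W`. -/
def Vbar (i : Fin 2) (W : Matrix (EIdx n i) (EIdx n i) ℝ) :
    Matrix (YIdx n m i) (YIdx n m i) ℝ :=
  Matrix.fromBlocks (g.costR i) 0 0 W

/-- The matrix that multiplies `m̃ = (m̃^1, m̃^2)` in the linear equation for `m̃`: in block row `i`,
it is `D^{ui}ᵀ V̄^i D^{ui}` at the place of `m̃^i`, plus `D^{ui}ᵀ V̄^i C^i`. -/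
def mLhs (t : ℕ) (Sg : Cov n) (L : Gain n m)
    (W : ∀ i, Matrix (EIdx n i) (EIdx n i) ℝ) : Matrix (Idx m) (Idx m) ℝ :=
  Matrix.of fun p q =>
    ((g.Du t Sg L p.1)ᵀ * g.Vbar p.1 (W p.1) *
      (g.Du t Sg L p.1 * (inj m p.1)ᵀ + g.Cm t Sg L p.1)) p.2 q

/-- The matrix that multiplies `x̂` in the linear equation for `m̃`: block row `i` is
`D^{ui}ᵀ V̄^i [D^{ei}]_{23}`. -/
def mRhs (t : ℕ) (Sg : Cov n) (L : Gain n m)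
    (W : ∀ i, Matrix (EIdx n i) (EIdx n i) ℝ) : Matrix (Idx m) (Idx n) ℝ :=
  Matrix.of fun p q =>
    ((g.Du t Sg L p.1)ᵀ * g.Vbar p.1 (W p.1) * g.Dxhat t Sg L p.1) p.2 q

/-- The matrix `M̃_t = -[mLhs]⁻¹ [mRhs]`, with the pseudo-inverse. -/
def Mt (t : ℕ) (Sg : Cov n) (L : Gain n m)
    (W : ∀ i, Matrix (EIdx n i) (EIdx n i) ℝ) : Matrix (Idx m) (Idx n) ℝ :=
  -(pinv (g.mLhs t Sg L W) * g.mRhs t Sg L W)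

/-- `F̃_t^i = [D^{ui} L^i, D^{ui} M^i + C^i M] + D^{ei}`. -/
def Ft (t : ℕ) (Sg : Cov n) (L : Gain n m)
    (W : ∀ i, Matrix (EIdx n i) (EIdx n i) ℝ) (i : Fin 2) :
    Matrix (YIdx n m i) (EIdx n i) ℝ :=
  Matrix.fromCols
    (g.Du t Sg L i * L i + g.Dx t i)
    (g.Du t Sg L i * ((inj m i)ᵀ * g.Mt t Sg L W) + g.Cm t Sg L i * g.Mt t Sg L W
      + g.Dxhat t Sg L i)

/-- The value matrices with `k` stages to go, that is, at time `T + 1 - k`, for the gains `L`. -/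
def valMatAux (L : ℕ → Cov n → Gain n m) :
    ℕ → Cov n → ∀ i : Fin 2, Matrix (EIdx n i) (EIdx n i) ℝ
  | 0 => fun _ _ => 0
  | k + 1 => fun Sg i =>
      let t := g.horizon - k
      let W := valMatAux L k (g.phiS t Sg (L t Sg))
      (g.Ft t Sg (L t Sg) W i)ᵀ * g.Vbar i (W i) * g.Ft t Sg (L t Sg) W i

/-- The value matrix `V_t^i(Σ)` for the gains `L`: it is `0` at time `T + 1`, and
`V_t^i = F̃_t^iᵀ V̄_t^i F̃_t^i`. -/
def valMat (L : ℕ → Cov n → Gain n m) (t : ℕ) (Sg : Cov n) (i : Fin 2) :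
    Matrix (EIdx n i) (EIdx n i) ℝ :=
  g.valMatAux L (g.horizon + 1 - t) Sg i

/-- The next value matrices `V_{t+1}^i(φ_s(Σ, L_t(Σ)))`. -/
def nextValMat (L : ℕ → Cov n → Gain n m) (t : ℕ) (Sg : Cov n) (i : Fin 2) :
    Matrix (EIdx n i) (EIdx n i) ℝ :=
  g.valMat L (t + 1) (g.phiS t Sg (L t Sg)) i

/-- The scalar `ρ^i` with `k` stages to go, that is, at time `T + 1 - k`, for the gains `L`. -/
def rhoAux (L : ℕ → Cov n → Gain n m) : ℕ → Cov n → Fin 2 → ℝ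
  | 0 => fun _ _ => 0
  | k + 1 => fun Sg i =>
      let t := g.horizon - k
      let W := g.nextValMat L t Sg i
      let J := g.Jm t Sg (L t Sg) i
      (Sg (other i) * (Jᵀ * g.Vbar i W * J)).trace + (g.Q i * W.toBlocks₁₁).trace
        + rhoAux L k (g.phiS t Sg (L t Sg)) i

/-- The scalar `ρ_t^i(Σ)` for the gains `L`. -/
def rho (L : ℕ → Cov n → Gain n m) (t : ℕ) (Sg : Cov n) (i : Fin 2) : ℝ :=
  g.rhoAux L (g.horizon + 1 - t) Sg i

/-- The algebraic fixed point equation for the gains at time `t`: for both players,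
`(D^{ui}ᵀ V̄^i D^{ui}) L^i = -D^{ui}ᵀ V̄^i [D^{ei}]_1`. -/
def GainEquation (L : ℕ → Cov n → Gain n m) (t : ℕ) (Sg : Cov n) : Prop :=
  ∀ i : Fin 2,
    ((g.Du t Sg (L t Sg) i)ᵀ * g.Vbar i (g.nextValMat L t Sg i) * g.Du t Sg (L t Sg) i) * L t Sg i
      = -((g.Du t Sg (L t Sg) i)ᵀ * g.Vbar i (g.nextValMat L t Sg i) * g.Dx t i)

/-- The matrices `D^{ui}ᵀ V̄^i D^{ui}` at time `t` are positive definite. -/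
def HessianPosDef (L : ℕ → Cov n → Gain n m) (t : ℕ) (Sg : Cov n) : Prop :=
  ∀ i : Fin 2,
    ((g.Du t Sg (L t Sg) i)ᵀ * g.Vbar i (g.nextValMat L t Sg i) * g.Du t Sg (L t Sg) i).PosDef

/-- The linear equation for `m̃_t` is solvable (e.g. its matrix is invertible). -/
def OffsetSolvable (L : ℕ → Cov n → Gain n m) (t : ℕ) (Sg : Cov n) : Prop :=
  ∃ M : Matrix (Idx m) (Idx n) ℝ,
    g.mLhs t Sg (L t Sg) (g.nextValMat L t Sg) * M = -g.mRhs t Sg (L t Sg) (g.nextValMat L t Sg)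

/-- The offset matrix `M̃_t(Σ)` for the gains `L`. -/
def offsetMat (L : ℕ → Cov n → Gain n m) (t : ℕ) (Sg : Cov n) : Matrix (Idx m) (Idx n) ℝ :=
  g.Mt t Sg (L t Sg) (g.nextValMat L t Sg)

/-- The action `L̃_t^i x + m̃_t^i` of player `i`, where `m̃_t = M̃_t x̂`. -/
def linAction (L : ℕ → Cov n → Gain n m) (t : ℕ) (Sg : Cov n) (xhat : ∀ j, Sp n j)
    (i : Fin 2) (x : Sp n i) : Sp m i :=
  WithLp.toLp 2 (L t Sg i *ᵥ x.ofLp) + comp (g.offsetMat L t Sg *ᵥ flat xhat) i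

end Game

end LQG

end

/-! Let a belief be `N(μ, S)` and the strategy affine, `x ↦ L x + c`. The type splits as `μ + G y +
z`, where `y ∼ N(0, L S Lᵀ)` is the random part of the action, `G = S Lᵀ (L S Lᵀ)⁺` is the
regression matrix, and `z` is an independent Gaussian residual with `L z = 0` almost surely
(`map_regr_add_resid`, `ae_act_regr_add_resid`). Seeing the action in a small ball therefore
localizes `y` and leaves `z` untouched. The average over `z` of a bounded continuous function is
continuous in `y`, so the ball averages converge, and the Bayes update is Gaussian, with a
covariance independent of the action and a mean affine in it (`isBayes_gaussian`).

The matrix `L G` is the orthogonal projection onto the range of `L S Lᵀ`, which is the direction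
space of the on-path actions. The nearest on-path action is thus given by this projection, and since
`G L G = G`, rule (N) leads to the same affine formula for every action. Under rule (P) the formula
also survives if `L S Lᵀ` is invertible (nothing is off path) or zero (then `G = 0`, and there is
nothing to learn). `UpdatesTo` records this common conclusion, so that both rules are treated by
`isBackwardSolution_of_updatesTo`.

Because all beliefs move affinely, every variable in the cost of player `i` is affine in her action,
in the deviation of the other type from its mean, and in her noise (`allVars_eq`). Her problem is to
minimize the expectation of `quad V̄ (a + D u + η)` with `η` centred Gaussian and independent of
`u`. The noise contributes only a trace, which goes into `ρ`, and with `Dᵀ V̄ D` positive definite a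
stationary action is optimal, also among randomized ones. The gain and offset equations together say
`Dᵀ V̄ F̃ = 0` (`Du_transpose_mul_Ft`): the prescribed action is stationary for every `e`. Its cost
is `quad (F̃ᵀ V̄ F̃; e)` plus a constant, which is the recursion defining the value. -/

noncomputable section

namespace LQG

variable {n m : Fin 2 → ℕ}

/-! ### Gaussian measures on Euclidean spaces -/

section Gaussian

variable {a b c : Type*} [Fintype b] [Fintype c]

/-- The action of a matrix on Euclidean vectors. -/
def act (M : Matrix a b ℝ) (x : EuclideanSpace ℝ b) : EuclideanSpace ℝ a :=
  WithLp.toLp 2 (M *ᵥ x.ofLp)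

@[simp] theorem ofLp_act (M : Matrix a b ℝ) (x : EuclideanSpace ℝ b) :
    (act M x).ofLp = M *ᵥ x.ofLp := rfl

@[fun_prop] theorem continuous_act (M : Matrix a b ℝ) : Continuous (act M) := by
  unfold act
  fun_prop

@[fun_prop] theorem measurable_act [Finite a] (M : Matrix a b ℝ) : Measurable (act M) :=
  (continuous_act M).measurable

theorem act_add (M : Matrix a b ℝ) (x y : EuclideanSpace ℝ b) :
    act M (x + y) = act M x + act M y := by
  ext; simp [act, mulVec_add]

theorem act_sub (M : Matrix a b ℝ) (x y : EuclideanSpace ℝ b) :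
    act M (x - y) = act M x - act M y := by
  ext; simp [act, mulVec_sub]

theorem act_zero (M : Matrix a b ℝ) : act M (0 : EuclideanSpace ℝ b) = 0 := by
  ext; simp [act]

theorem sub_act (M N : Matrix a b ℝ) (x : EuclideanSpace ℝ b) :
    act (M - N) x = act M x - act N x := by
  ext; simp [act, sub_mulVec]

theorem act_act (M : Matrix a b ℝ) (N : Matrix b c ℝ) (x : EuclideanSpace ℝ c) :
    act M (act N x) = act (M * N) x := by
  ext; simp [act]

theorem one_act [Fintype a] [DecidableEq a] (x : EuclideanSpace ℝ a) : act (1 : Matrix a a ℝ) x = x := by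
  ext; simp [act]

theorem inner_act [Fintype a] (M : Matrix a b ℝ) (x : EuclideanSpace ℝ b) (t : EuclideanSpace ℝ a) :
    inner ℝ (act M x) t = inner ℝ x (act Mᵀ t) := by
  simp only [EuclideanSpace.inner_eq_star_dotProduct, ofLp_act, star_trivial]
  rw [dotProduct_mulVec, ← mulVec_transpose]

theorem posSemidef_sandwich [Finite a] {S : Matrix b b ℝ} (hS : S.PosSemidef) (M : Matrix a b ℝ) :
    (M * S * Mᵀ).PosSemidef := by
  simpa [conjTranspose_eq_transpose_of_trivial] using hS.mul_mul_conjTranspose_same M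

variable [Fintype a] [DecidableEq a] [DecidableEq b]

/-- Characteristic functions: the matrix moves to the frequency as its transpose, and the shift
contributes a phase. No rank condition is needed, so degenerate covariances are covered. -/
theorem map_affine_multivariateGaussian {S : Matrix b b ℝ} (hS : S.PosSemidef)
    (μ : EuclideanSpace ℝ b) (M : Matrix a b ℝ) (v : EuclideanSpace ℝ a) :
    (multivariateGaussian μ S).map (fun x => v + act M x) =
      multivariateGaussian (v + act M μ) (M * S * Mᵀ) := by
  have hm : Measurable fun x => v + act M x := by fun_prop
  have := Measure.isProbabilityMeasure_map (μ := multivariateGaussian μ S) hm.aemeasurable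
  refine Measure.ext_of_charFun (funext fun t => ?_)
  have h1 : charFun ((multivariateGaussian μ S).map (fun x => v + act M x)) t =
      Complex.exp ((inner ℝ v t : ℝ) * Complex.I) *
        charFun (multivariateGaussian μ S) (act Mᵀ t) := by
    rw [charFun_apply, integral_map hm.aemeasurable (by fun_prop), charFun_apply,
      ← integral_const_mul]
    refine integral_congr_ae (ae_of_all _ fun x => ?_)
    simp only [inner_add_left, inner_act, Complex.ofReal_add, add_mul, Complex.exp_add]
  rw [h1, charFun_multivariateGaussian hS,
    charFun_multivariateGaussian (posSemidef_sandwich hS M), ← Complex.exp_add]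
  congr 1
  have h2 : (act Mᵀ t).ofLp ⬝ᵥ S *ᵥ (act Mᵀ t).ofLp = t.ofLp ⬝ᵥ (M * S * Mᵀ) *ᵥ t.ofLp := by
    simp only [ofLp_act, ← mulVec_mulVec]
    rw [dotProduct_mulVec t.ofLp, ← mulVec_transpose]
  rw [h2, inner_add_right, real_inner_comm v,
    real_inner_comm μ, ← inner_act, real_inner_comm (act M μ) t]
  push_cast
  ring

theorem map_add_multivariateGaussian {S R : Matrix a a ℝ} (hS : S.PosSemidef)
    (hR : R.PosSemidef) (μ ν : EuclideanSpace ℝ a) :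
    ((multivariateGaussian μ S).prod (multivariateGaussian ν R)).map (fun p => p.1 + p.2) =
      multivariateGaussian (μ + ν) (S + R) := by
  change Measure.conv _ _ = _
  refine Measure.ext_of_charFun (funext fun t => ?_)
  rw [charFun_conv, charFun_multivariateGaussian hS, charFun_multivariateGaussian hR,
    charFun_multivariateGaussian (hS.add hR), ← Complex.exp_add]
  congr 1
  simp only [inner_add_right, add_mulVec, dotProduct_add]
  push_cast
  ring

theorem multivariateGaussian_zero_cov (μ : EuclideanSpace ℝ a) :
    multivariateGaussian μ (0 : Matrix a a ℝ) = Measure.dirac μ := by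
  simp [multivariateGaussian, Measure.map_const]

/-- A centred Gaussian vector satisfies the linear equations that its covariance satisfies. -/
theorem ae_act_eq_zero {S : Matrix b b ℝ} (hS : S.PosSemidef) {M : Matrix a b ℝ}
    (h : M * S * Mᵀ = 0) : ∀ᵐ x ∂(multivariateGaussian 0 S), act M x = 0 := by
  -- The image under `M` has mean and covariance zero, hence is the point mass at zero.
  have h1 := map_affine_multivariateGaussian hS 0 M 0
  rw [h, multivariateGaussian_zero_cov, act_zero, add_zero] at h1
  have h2 : ∀ᵐ y ∂(Measure.dirac (0 : EuclideanSpace ℝ a)), y = 0 := by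
    rw [ae_dirac_eq]; rfl
  rw [← h1] at h2
  have := ae_of_ae_map (by fun_prop) h2
  simpa using this

/-- The one-dimensional Gaussian charges open sets because Lebesgue measure is absolutely continuous
with respect to it; this passes to products and to surjective continuous images. -/
instance isOpenPosMeasure_stdGaussian :
    (stdGaussian (EuclideanSpace ℝ a)).IsOpenPosMeasure := by
  have : (gaussianReal 0 1).IsOpenPosMeasure :=
    (gaussianReal_absolutelyContinuous' 0 one_ne_zero).isOpenPosMeasure
  rw [← map_pi_eq_stdGaussian]
  exact (PiLp.continuous_toLp 2 _).isOpenPosMeasure_map (WithLp.toLp_surjective 2)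

-- The Gaussian is the image of the standard one under `√S`, and `S x = √S (√S x)` lies in the range
-- of `√S`. Hence the support contains the whole range of `S`.
open scoped MatrixOrder in
theorem multivariateGaussian_ball_pos {S : Matrix a a ℝ} (hS : S.PosSemidef)
    (x : EuclideanSpace ℝ a) {ε : ℝ} (hε : 0 < ε) :
    0 < (multivariateGaussian 0 S).real (Metric.ball (act S x) ε) := by
  rw [measureReal_def, ENNReal.toReal_pos_iff]
  refine ⟨?_, measure_lt_top _ _⟩
  have hc : Continuous fun y : EuclideanSpace ℝ a =>
    (0 : EuclideanSpace ℝ a) + toEuclideanCLM (𝕜 := ℝ) (CFC.sqrt S) y := by fun_prop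
  rw [multivariateGaussian, Measure.map_apply hc.measurable Metric.isOpen_ball.measurableSet]
  refine (Metric.isOpen_ball.preimage hc).measure_pos _
    ⟨toEuclideanCLM (𝕜 := ℝ) (CFC.sqrt S) x, ?_⟩
  have : toEuclideanCLM (𝕜 := ℝ) (CFC.sqrt S) (toEuclideanCLM (𝕜 := ℝ) (CFC.sqrt S) x)
      = act S x := by
    rw [← ContinuousLinearMap.comp_apply, ← ContinuousLinearMap.mul_def, ← map_mul]
    rw [CFC.sqrt_mul_sqrt_self _ hS.nonneg]
    rfl
  simp [this, hε]

/-- The averages of a continuous function over small balls tend to its value at the centre. -/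
theorem tendsto_average_ball {E : Type*} [PseudoMetricSpace E] [MeasurableSpace E]
    [BorelSpace E] (μ : Measure E) [IsFiniteMeasure μ] (h : E → ℝ) (hc : Continuous h)
    (hi : Integrable h μ) (v : E) (hv : ∀ ε, 0 < ε → 0 < μ.real (Metric.ball v ε)) :
    Tendsto (fun ε => (∫ y in Metric.ball v ε, h y ∂μ) / μ.real (Metric.ball v ε))
      (𝓝[>] 0) (𝓝 (h v)) := by
  rw [Metric.tendsto_nhds]
  intro δ hδ
  -- Averaging gives only a weak inequality; half of `δ` leaves room for the strict one.
  obtain ⟨r, hr, H⟩ := Metric.continuous_iff.1 hc v (δ / 2) (half_pos hδ)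
  filter_upwards [Ioo_mem_nhdsGT hr] with ε hε
  have hp := hv ε hε.1
  have e : (∫ y in Metric.ball v ε, h y ∂μ) / μ.real (Metric.ball v ε) - h v =
      (∫ y in Metric.ball v ε, (h y - h v) ∂μ) / μ.real (Metric.ball v ε) := by
    rw [integral_sub hi.integrableOn (integrable_const _), setIntegral_const, smul_eq_mul]
    field_simp
  rw [Real.dist_eq, e, abs_div, abs_of_pos hp, div_lt_iff₀ hp]
  have := norm_setIntegral_le_of_norm_le_const (μ := μ) (s := Metric.ball v ε)
    (f := fun y => h y - h v) (C := δ / 2) (measure_lt_top _ _)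
    (fun y hy => (H y (lt_trans hy hε.2)).le)
  rw [Real.norm_eq_abs] at this
  nlinarith

end Gaussian

/-! ### The conditional law of a Gaussian vector -/

section Conditioning

theorem PosSemidef.transpose_eq {b : Type*} {S : Matrix b b ℝ} (hS : S.PosSemidef) :
    Sᵀ = S := by
  simpa [conjTranspose_eq_transpose_of_trivial] using hS.isHermitian.eq

variable {a b : Type*} [Fintype a] [Fintype b]

theorem isPinv_pinv (M : Matrix a b ℝ) : IsPinv M (pinv M) := (exists_isPinv M).choose_spec

theorem pinv_transpose_of_symm {M : Matrix a a ℝ} (hM : Mᵀ = M) : (pinv M)ᵀ = pinv M := by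
  obtain ⟨h1, h2, h3, h4⟩ := isPinv_pinv M
  refine IsPinv.unique (M := M) ⟨?_, ?_, ?_, ?_⟩ (isPinv_pinv M)
  · simpa [transpose_mul, hM, Matrix.mul_assoc] using congrArg transpose h1
  · simpa [transpose_mul, hM, Matrix.mul_assoc] using congrArg transpose h2
  · simpa [transpose_mul, hM] using h4.symm
  · simpa [transpose_mul, hM] using h3.symm

theorem pinv_zero : pinv (0 : Matrix a b ℝ) = 0 := by
  have := (isPinv_pinv (0 : Matrix a b ℝ)).2.1
  simpa using this.symm

/-- The regression matrix of a Gaussian vector with covariance `S` on its image under `L`. -/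
def regr (S : Matrix b b ℝ) (L : Matrix a b ℝ) : Matrix b a ℝ := S * Lᵀ * pinv (L * S * Lᵀ)

theorem mul_regr (S : Matrix b b ℝ) (L : Matrix a b ℝ) :
    L * regr S L = L * S * Lᵀ * pinv (L * S * Lᵀ) := by
  simp only [regr, Matrix.mul_assoc]

/-- The first Penrose equation. It is what makes `L * regr S L` act as the identity on the range of
`L S Lᵀ`, without invertibility. -/
theorem one_sub_mul_regr_mul [DecidableEq a] (S : Matrix b b ℝ) (L : Matrix a b ℝ) :
    (1 - L * regr S L) * (L * S * Lᵀ) = 0 := by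
  rw [mul_regr, Matrix.sub_mul, (isPinv_pinv (L * S * Lᵀ)).1, Matrix.one_mul, sub_self]

variable [DecidableEq b]

/-- The covariance of the residual of the regression on the image under `L`. -/
def resid (S : Matrix b b ℝ) (L : Matrix a b ℝ) : Matrix b b ℝ :=
  (1 - regr S L * L) * S * (1 - regr S L * L)ᵀ

theorem resid_posSemidef {S : Matrix b b ℝ} (hS : S.PosSemidef) (L : Matrix a b ℝ) :
    (resid S L).PosSemidef := posSemidef_sandwich hS _

/-- Law of total covariance: explained part plus residual. All the cross terms equal `S Lᵀ (L S Lᵀ)⁺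
L S`, by the second Penrose equation and the symmetry of the pseudo-inverse. -/
theorem regr_add_resid {S : Matrix b b ℝ} (hS : S.PosSemidef) (L : Matrix a b ℝ) :
    regr S L * (L * S * Lᵀ) * (regr S L)ᵀ + resid S L = S := by
  have hT : (L * S * Lᵀ)ᵀ = L * S * Lᵀ := PosSemidef.transpose_eq (posSemidef_sandwich hS L)
  have hP := pinv_transpose_of_symm hT
  have hST := PosSemidef.transpose_eq hS
  have h2 := (isPinv_pinv (L * S * Lᵀ)).2.1
  have e1 : regr S L * L * S = S * Lᵀ * pinv (L * S * Lᵀ) * (L * S) := by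
    simp only [regr, Matrix.mul_assoc]
  have e2 : S * (regr S L * L)ᵀ = S * Lᵀ * pinv (L * S * Lᵀ) * (L * S) := by
    simp only [regr, transpose_mul, transpose_transpose, hP, hST]
    simp only [Matrix.mul_assoc]
  have e3 : regr S L * L * S * (regr S L * L)ᵀ = S * Lᵀ * pinv (L * S * Lᵀ) * (L * S) := by
    rw [Matrix.mul_assoc _ S, e2]
    calc _ = S * Lᵀ * (pinv (L * S * Lᵀ) * (L * S * Lᵀ) * pinv (L * S * Lᵀ)) * (L * S) := by
          simp only [regr, Matrix.mul_assoc]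
      _ = _ := by rw [h2]
  have e4 : regr S L * (L * S * Lᵀ) * (regr S L)ᵀ = regr S L * L * S * (regr S L * L)ᵀ := by
    simp only [transpose_mul, Matrix.mul_assoc]
  rw [e4]
  simp only [resid, transpose_sub, transpose_one, Matrix.sub_mul, Matrix.mul_sub, Matrix.one_mul,
    Matrix.mul_one]
  rw [e2, e3, e1]
  abel

variable [DecidableEq a]

/-- Moving `L` past `1 - G L` turns it into `1 - L G`, which kills `L S Lᵀ`. So the residual is
invisible in the action. -/
theorem mul_resid_mul (S : Matrix b b ℝ) (L : Matrix a b ℝ) :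
    L * resid S L * Lᵀ = 0 := by
  have h : L * (1 - regr S L * L) = (1 - L * regr S L) * L := by
    simp only [Matrix.mul_sub, Matrix.sub_mul, Matrix.mul_one, Matrix.one_mul, Matrix.mul_assoc]
  calc L * resid S L * Lᵀ = L * (1 - regr S L * L) * S * (L * (1 - regr S L * L))ᵀ := by
        simp only [resid, transpose_mul, Matrix.mul_assoc]
    _ = (1 - L * regr S L) * (L * S * Lᵀ) * (1 - L * regr S L)ᵀ := by
        rw [h]; simp only [transpose_mul, Matrix.mul_assoc]
    _ = 0 := by rw [one_sub_mul_regr_mul, Matrix.zero_mul]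

/-- A Gaussian vector is the sum of its regression on its image under `L` and an independent
residual. -/
theorem map_regr_add_resid {S : Matrix b b ℝ} (hS : S.PosSemidef) (L : Matrix a b ℝ)
    (μ : EuclideanSpace ℝ b) :
    ((multivariateGaussian 0 (L * S * Lᵀ)).prod (multivariateGaussian 0 (resid S L))).map
      (fun p => μ + act (regr S L) p.1 + p.2) = multivariateGaussian μ S := by
  have hG := posSemidef_sandwich hS L
  have h0 := map_affine_multivariateGaussian hG 0 (regr S L) μ
  have h := map_add_multivariateGaussian (posSemidef_sandwich hG (regr S L))
    (resid_posSemidef hS L) μ 0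
  rw [act_zero, add_zero] at h0
  rw [regr_add_resid hS, add_zero, ← h0,
    ← Measure.map_id (μ := multivariateGaussian 0 (resid S L)),
    Measure.map_prod_map _ _ (by fun_prop) measurable_id,
    Measure.map_map (by fun_prop) (by fun_prop)] at h
  exact h

/-- The law of a linear system driven by independent Gaussian state and noise. -/
theorem map_linear_multivariateGaussian {S : Matrix b b ℝ} (hS : S.PosSemidef)
    {Q : Matrix a a ℝ} (hQ : Q.PosSemidef) (A : Matrix a b ℝ) (μ : EuclideanSpace ℝ b)
    (v : EuclideanSpace ℝ a) :
    ((multivariateGaussian μ S).prod (multivariateGaussian 0 Q)).map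
      (fun p => v + act A p.1 + p.2) = multivariateGaussian (v + act A μ) (A * S * Aᵀ + Q) := by
  have h := map_add_multivariateGaussian (posSemidef_sandwich hS A) hQ (v + act A μ) 0
  rw [add_zero, ← map_affine_multivariateGaussian hS,
    ← Measure.map_id (μ := multivariateGaussian 0 Q),
    Measure.map_prod_map _ _ (by fun_prop) measurable_id,
    Measure.map_map (by fun_prop) (by fun_prop)] at h
  exact h

/-- Almost surely `L G` fixes the image variable and `L` annihilates the residual, so the action
reveals the first component exactly. -/
theorem ae_act_regr_add_resid {S : Matrix b b ℝ} (hS : S.PosSemidef) (L : Matrix a b ℝ) :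
    ∀ᵐ p ∂((multivariateGaussian 0 (L * S * Lᵀ)).prod (multivariateGaussian 0 (resid S L))),
      act L (act (regr S L) p.1 + p.2) = p.1 := by
  have h1 : ∀ᵐ y ∂(multivariateGaussian 0 (L * S * Lᵀ)), act (1 - L * regr S L) y = 0 :=
    ae_act_eq_zero (posSemidef_sandwich hS L) (by rw [one_sub_mul_regr_mul, Matrix.zero_mul])
  have h2 := ae_act_eq_zero (resid_posSemidef hS L) (mul_resid_mul S L)
  filter_upwards [Measure.quasiMeasurePreserving_fst.ae h1,
    Measure.quasiMeasurePreserving_snd.ae h2] with p hp1 hp2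
  rw [sub_act, one_act, sub_eq_zero] at hp1
  rw [act_add, act_act, ← hp1, hp2, add_zero]

/-- Integrals against a Gaussian measure localized to the values of an affine image. -/
theorem integral_indicator_ball {S : Matrix b b ℝ} (hS : S.PosSemidef) (L : Matrix a b ℝ)
    (μ : EuclideanSpace ℝ b) (c v : EuclideanSpace ℝ a) (ε : ℝ)
    (k : EuclideanSpace ℝ b →ᵇ ℝ) :
    ∫ x, (Measure.dirac (act L x + c)).real (Metric.ball v ε) * k x ∂(multivariateGaussian μ S) =
      ∫ y in Metric.ball (v - c - act L μ) ε,
        ∫ z, k (μ + act (regr S L) y + z) ∂(multivariateGaussian 0 (resid S L))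
        ∂(multivariateGaussian 0 (L * S * Lᵀ)) := by
  have hd : ∀ x, (Measure.dirac (act L x + c)).real (Metric.ball v ε) * k x =
      {x | act L x + c ∈ Metric.ball v ε}.indicator k x := by
    intro x
    rw [measureReal_def, Measure.dirac_apply' _ Metric.isOpen_ball.measurableSet]
    by_cases h : act L x + c ∈ Metric.ball v ε
    · rw [Set.indicator_of_mem h, Set.indicator_of_mem (by exact h)]; simp
    · rw [Set.indicator_of_notMem h, Set.indicator_of_notMem (by exact h)]; simp
  have hm : MeasurableSet {x | act L x + c ∈ Metric.ball v ε} :=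
    (Metric.isOpen_ball.preimage (by fun_prop : Continuous fun x => act L x + c)).measurableSet
  simp_rw [hd]
  rw [← map_regr_add_resid hS L μ, integral_map (by fun_prop)
    (k.continuous.measurable.indicator hm).aestronglyMeasurable]
  have hi : Integrable (fun p : EuclideanSpace ℝ a × EuclideanSpace ℝ b =>
      k (μ + act (regr S L) p.1 + p.2))
      ((multivariateGaussian 0 (L * S * Lᵀ)).prod (multivariateGaussian 0 (resid S L))) :=
    (BoundedContinuousFunction.integrable _
      (k.compContinuous ⟨fun p : EuclideanSpace ℝ a × EuclideanSpace ℝ b =>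
        μ + act (regr S L) p.1 + p.2, by fun_prop⟩))
  have hB : MeasurableSet (Metric.ball (v - c - act L μ) ε) := Metric.isOpen_ball.measurableSet
  -- Almost surely the event depends on the image variable alone, so it is a cylinder over a ball
  -- and the integral becomes iterated.
  have hE : (fun p : EuclideanSpace ℝ a × EuclideanSpace ℝ b =>
        {x | act L x + c ∈ Metric.ball v ε}.indicator k (μ + act (regr S L) p.1 + p.2))
      =ᵐ[(multivariateGaussian 0 (L * S * Lᵀ)).prod (multivariateGaussian 0 (resid S L))]
      (Metric.ball (v - c - act L μ) ε ×ˢ Set.univ).indicator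
        fun p => k (μ + act (regr S L) p.1 + p.2) := by
    filter_upwards [ae_act_regr_add_resid hS L] with p hp
    have : act L (μ + act (regr S L) p.1 + p.2) + c ∈ Metric.ball v ε ↔
        p.1 ∈ Metric.ball (v - c - act L μ) ε := by
      rw [add_assoc μ, act_add, hp, mem_ball_iff_norm, mem_ball_iff_norm]
      rw [show act L μ + p.1 + c - v = p.1 - (v - c - act L μ) by abel]
    by_cases h : p.1 ∈ Metric.ball (v - c - act L μ) ε
    · rw [Set.indicator_of_mem (by exact this.2 h), Set.indicator_of_mem (Set.mk_mem_prod h (Set.mem_univ _))]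
    · rw [Set.indicator_of_notMem (by exact fun h' => h (this.1 h')),
        Set.indicator_of_notMem fun h' => h h'.1]
  rw [integral_congr_ae hE, integral_indicator (hB.prod MeasurableSet.univ),
    setIntegral_prod _ hi.integrableOn]
  simp

end Conditioning

/-! ### The belief update for Gaussian beliefs and affine strategies -/

section Update

theorem dyn_eq (g : Game n m) (t : ℕ) (i : Fin 2) (x : Sp n i) (u : Idx m → ℝ) (w : Sp n i) :
    g.dyn t i x u w = WithLp.toLp 2 (g.B t i *ᵥ u) + act (g.A t i) x + w := by
  ext a
  simp only [Game.dyn, act, PiLp.add_apply, Pi.add_apply]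
  ring

variable {i : Fin 2} {S : Matrix (Fin (n i)) (Fin (n i)) ℝ} (hS : S.PosSemidef)
  (L : Matrix (Fin (m i)) (Fin (n i)) ℝ) (μ : Sp n i) (c : Sp m i)
  {γ : Kernel (Sp n i) (Sp m i)} (hγ : ∀ x, γ x = Measure.dirac (act L x + c))

include hS hγ

theorem actionMass_gaussian (v : Sp m i) (ε : ℝ) :
    actionMass (multivariateGaussian μ S) γ v ε =
      (multivariateGaussian 0 (L * S * Lᵀ)).real (Metric.ball (v - c - act L μ) ε) := by
  have h := integral_indicator_ball hS L μ c v ε (BoundedContinuousFunction.const _ 1)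
  simp only [BoundedContinuousFunction.const_apply, mul_one, integral_const, probReal_univ,
    smul_eq_mul] at h
  simp only [actionMass, hγ, h]
  simp

/-- The support of a Gaussian is its mean plus the range of its covariance, and `L * regr S L` is
the projection onto that range. -/
theorem onPath_gaussian_iff (v : Sp m i) :
    OnPath (multivariateGaussian μ S) γ v ↔
      act (L * regr S L) (v - c - act L μ) = v - c - act L μ := by
  simp only [OnPath, actionMass_gaussian hS L μ c hγ]
  have hG := posSemidef_sandwich hS L
  constructor
  · intro h
    by_contra hne
    have ho : IsOpen {y : Sp m i | act (1 - L * regr S L) y ≠ 0} :=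
      isOpen_ne_fun (by fun_prop) continuous_const
    have hv : v - c - act L μ ∈ {y : Sp m i | act (1 - L * regr S L) y ≠ 0} := by
      intro h0
      rw [sub_act, one_act, sub_eq_zero] at h0
      exact hne h0.symm
    obtain ⟨ε, hε, hb⟩ := Metric.isOpen_iff.1 ho _ hv
    -- The points not fixed by the projection form an open null set, so a ball around such a point
    -- has mass zero.
    have h0 : ∀ᵐ y ∂(multivariateGaussian 0 (L * S * Lᵀ)), act (1 - L * regr S L) y = 0 :=
      ae_act_eq_zero hG (by rw [one_sub_mul_regr_mul, Matrix.zero_mul])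
    have h1 := measure_mono_null hb (ae_iff.1 h0)
    have h2 := h ε hε
    rw [measureReal_def, h1] at h2
    simp at h2
  · intro h ε hε
    -- A fixed point is `L S Lᵀ` applied to some vector, the form required by
    -- `multivariateGaussian_ball_pos`.
    rw [← h, mul_regr, ← act_act]
    exact multivariateGaussian_ball_pos hG _ hε

/-- In the limit of shrinking balls the regression variable is frozen at its observed value, while
residual and noise are integrated out. The drift keeps `u`, which may differ from `v` in player
`i`'s part: this is what rule (N) needs. -/
theorem isBayes_gaussian (g : Game n m) (t : ℕ) (u : Idx m → ℝ) (v : Sp m i)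
    (hv : OnPath (multivariateGaussian μ S) γ v) :
    g.IsBayes t i (multivariateGaussian μ S) γ v u
      (multivariateGaussian (WithLp.toLp 2 (g.B t i *ᵥ u) +
        act (g.A t i) (μ + act (regr S L) (v - c - act L μ)))
        (g.A t i * resid S L * (g.A t i)ᵀ + g.Q i)) := by
  refine ⟨hv, fun f => ?_⟩
  -- With the noise integrated out, the test function is a bounded continuous function of the
  -- current type.
  have hk : Continuous fun x => ∫ w, f (g.dyn t i x u w) ∂(g.noise i) := by
    simp only [dyn_eq]
    refine continuous_of_dominated (bound := fun _ => ‖f‖) (fun x => ?_) (fun x => ?_) ?_ ?_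
    · exact (f.continuous.comp (by fun_prop)).aestronglyMeasurable
    · exact ae_of_all _ fun w => f.norm_coe_le_norm _
    · have : IsProbabilityMeasure (g.noise i) := by unfold Game.noise; infer_instance
      exact integrable_const _
    · exact ae_of_all _ fun w => f.continuous.comp (by fun_prop)
  have hprob : IsProbabilityMeasure (g.noise i) := by unfold Game.noise; infer_instance
  let k : Sp n i →ᵇ ℝ := BoundedContinuousFunction.ofNormedAddCommGroup _ hk ‖f‖ fun x => by
    refine (norm_integral_le_of_norm_le_const (C := ‖f‖)
      (ae_of_all _ fun w => f.norm_coe_le_norm _)).trans ?_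
    simp
  have hk' : ∀ x, ∫ w, f (g.dyn t i x u w) ∂(g.noise i) = k x := fun x => rfl
  have hh : Continuous fun y =>
      ∫ z, k (μ + act (regr S L) y + z) ∂(multivariateGaussian 0 (resid S L)) := by
    refine continuous_of_dominated (bound := fun _ => ‖k‖) (fun x => ?_) (fun x => ?_) ?_ ?_
    · exact (k.continuous.comp (by fun_prop)).aestronglyMeasurable
    · exact ae_of_all _ fun w => k.norm_coe_le_norm _
    · exact integrable_const _
    · exact ae_of_all _ fun w => k.continuous.comp (by fun_prop)
  have hhi : Integrable (fun y =>
      ∫ z, k (μ + act (regr S L) y + z) ∂(multivariateGaussian 0 (resid S L)))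
      (multivariateGaussian 0 (L * S * Lᵀ)) := by
    refine Integrable.of_bound hh.aestronglyMeasurable ‖k‖ (ae_of_all _ fun y => ?_)
    refine (norm_integral_le_of_norm_le_const (C := ‖k‖)
      (ae_of_all _ fun w => k.norm_coe_le_norm _)).trans ?_
    simp
  have hlim := tendsto_average_ball (multivariateGaussian 0 (L * S * Lᵀ)) _ hh hhi
    (v - c - act L μ) (fun ε hε => by
      rw [← actionMass_gaussian hS L μ c hγ]; exact hv ε hε)
  have hval : ∫ z, k (μ + act (regr S L) (v - c - act L μ) + z)
      ∂(multivariateGaussian 0 (resid S L)) =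
      ∫ y, f y ∂(multivariateGaussian (WithLp.toLp 2 (g.B t i *ᵥ u) +
        act (g.A t i) (μ + act (regr S L) (v - c - act L μ)))
        (g.A t i * resid S L * (g.A t i)ᵀ + g.Q i)) := by
    have e := map_linear_multivariateGaussian (resid_posSemidef hS L) (g.Q_posSemidef i)
      (g.A t i) 0 (WithLp.toLp 2 (g.B t i *ᵥ u) +
        act (g.A t i) (μ + act (regr S L) (v - c - act L μ)))
    rw [act_zero, add_zero] at e
    have hc : Continuous fun p : Sp n i × Sp n i => WithLp.toLp 2 (g.B t i *ᵥ u) +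
        act (g.A t i) (μ + act (regr S L) (v - c - act L μ)) + act (g.A t i) p.1 + p.2 := by
      fun_prop
    rw [← e, integral_map (by fun_prop) f.continuous.aestronglyMeasurable, integral_prod]
    · refine integral_congr_ae (ae_of_all _ fun z => ?_)
      simp only [← hk', dyn_eq, act_add, Game.noise, add_assoc]
    · exact BoundedContinuousFunction.integrable _ (f.compContinuous ⟨_, hc⟩)
  rw [hval] at hlim
  refine hlim.congr fun ε => ?_
  rw [actionMass_gaussian hS L μ c hγ]
  congr 1
  rw [← integral_indicator_ball hS]
  simp only [hγ, hk']

omit hS hγ in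
theorem isBayes_unique {g : Game n m} {t : ℕ} {π π₁ π₂ : Measure (Sp n i)} {v : Sp m i}
    {u : Idx m → ℝ} [IsProbabilityMeasure π₁] [IsProbabilityMeasure π₂]
    (h₁ : g.IsBayes t i π γ v u π₁) (h₂ : g.IsBayes t i π γ v u π₂) : π₁ = π₂ :=
  ext_of_forall_integral_eq_of_IsFiniteMeasure fun f =>
    tendsto_nhds_unique (h₁.2 f) (h₂.2 f)

-- `nextBelief` is a choice among the admissible probability measures; uniqueness pins it down.
omit hS hγ in
theorem nextBelief_eq {upd : Game.UpdateRule n m} {t : ℕ} {π π' : Measure (Sp n i)}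
    {u : Idx m → ℝ} [IsProbabilityMeasure π'] (h : upd t i π γ u π')
    (hu : ∀ π'' : Measure (Sp n i), IsProbabilityMeasure π'' → upd t i π γ u π'' → π'' = π') :
    nextBelief upd t i π γ u = π' := by
  have hex : ∃ π'' : Measure (Sp n i), IsProbabilityMeasure π'' ∧ upd t i π γ u π'' :=
    ⟨π', inferInstance, h⟩
  rw [nextBelief, dif_pos hex]
  exact hu _ hex.choose_spec.1 hex.choose_spec.2

/-- The mean of the updated belief. -/
def updMean (g : Game n m) (t : ℕ) (S : Matrix (Fin (n i)) (Fin (n i)) ℝ)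
    (L : Matrix (Fin (m i)) (Fin (n i)) ℝ) (μ : Sp n i) (c : Sp m i) (u : Idx m → ℝ) : Sp n i :=
  WithLp.toLp 2 (g.B t i *ᵥ u) + act (g.A t i) (μ + act (regr S L) (comp u i - c - act L μ))

/-- `upd` sends the Gaussian belief to the Gaussian belief with mean `updMean`, and to no other
probability measure. -/
def UpdatesTo (g : Game n m) (upd : Game.UpdateRule n m) (t : ℕ)
    (S : Matrix (Fin (n i)) (Fin (n i)) ℝ) (L : Matrix (Fin (m i)) (Fin (n i)) ℝ) (μ : Sp n i)
    (c : Sp m i) (γ : Kernel (Sp n i) (Sp m i)) (u : Idx m → ℝ) : Prop :=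
  upd t i (multivariateGaussian μ S) γ u (multivariateGaussian (updMean g t S L μ c u)
      (g.A t i * resid S L * (g.A t i)ᵀ + g.Q i)) ∧
    nextBelief upd t i (multivariateGaussian μ S) γ u =
      multivariateGaussian (updMean g t S L μ c u) (g.A t i * resid S L * (g.A t i)ᵀ + g.Q i)

omit hS hγ in
theorem regr_mul_mul_regr : regr S L * (L * regr S L) = regr S L := by
  have h2 := (isPinv_pinv (L * S * Lᵀ)).2.1
  calc _ = S * Lᵀ * (pinv (L * S * Lᵀ) * (L * S * Lᵀ) * pinv (L * S * Lᵀ)) := by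
        simp only [regr, Matrix.mul_assoc]
    _ = _ := by rw [h2]; rfl

-- With the idempotence below, this makes `L * regr S L` an orthogonal projection, which is why
-- nearest points are given by it.
omit hS hγ in
theorem mul_regr_transpose : (L * regr S L)ᵀ = L * regr S L := by
  rw [mul_regr]; exact (isPinv_pinv (L * S * Lᵀ)).2.2.1

omit hS hγ in
theorem mul_regr_idem : L * regr S L * (L * regr S L) = L * regr S L := by
  rw [Matrix.mul_assoc, regr_mul_mul_regr]

/-- Pythagoras in the affine space of on-path actions: the error `u - p` is orthogonal to it, so `p`
is the only nearest point. -/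
theorem nearest_iff (u v : Sp m i) (hv : OnPath (multivariateGaussian μ S) γ v) :
    (∀ v', OnPath (multivariateGaussian μ S) γ v' → dist u v ≤ dist u v') ↔
      v = act (L * regr S L) (u - c - act L μ) + c + act L μ := by
  set p := act (L * regr S L) (u - c - act L μ) + c + act L μ with hp
  have hpon : OnPath (multivariateGaussian μ S) γ p := by
    rw [onPath_gaussian_iff hS L μ c hγ,
      show p - c - act L μ = act (L * regr S L) (u - c - act L μ) by rw [hp]; abel, act_act,
      mul_regr_idem]
  have key : ∀ v', OnPath (multivariateGaussian μ S) γ v' →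
      dist u v' ^ 2 = dist u p ^ 2 + dist p v' ^ 2 := by
    intro v' hv'
    rw [onPath_gaussian_iff hS L μ c hγ] at hv'
    have e1 : p - v' = act (L * regr S L) (u - v') := by
      rw [show u - v' = (u - c - act L μ) - (v' - c - act L μ) by abel, act_sub, hv', hp]
      abel
    have e2 : inner ℝ (u - p) (p - v') = (0 : ℝ) := by
      rw [e1, ← mul_regr_transpose L, ← inner_act,
        show u - p = (u - c - act L μ) - act (L * regr S L) (u - c - act L μ) by rw [hp]; abel,
        act_sub, act_act, mul_regr_idem, sub_self, inner_zero_left]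
    have e3 := norm_add_sq_real (u - p) (p - v')
    rw [e2, sub_add_sub_cancel] at e3
    simp only [dist_eq_norm, e3]
    ring
  constructor
  · intro h
    have h1 := h p hpon
    have h2 := key v hv
    have h3 : dist u v ^ 2 ≤ dist u p ^ 2 := by gcongr
    have h4 : dist p v ^ 2 ≤ 0 := by linarith
    exact (dist_eq_zero.1 (pow_eq_zero_iff two_ne_zero |>.1 (le_antisymm h4 (sq_nonneg _)))).symm
  · rintro rfl v' hv'
    have := key v' hv'
    exact le_of_sq_le_sq (by nlinarith [sq_nonneg (dist p v')]) dist_nonneg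

/-- Regressing on the projected action is the same as regressing on the action, since `G L G = G`;
hence one formula on and off path. -/
theorem bayesOrNearest_updatesTo (g : Game n m) (t : ℕ) (u : Idx m → ℝ) :
    UpdatesTo g g.bayesOrNearest t S L μ c γ u := by
  set p := act (L * regr S L) (comp u i - c - act L μ) + c + act L μ with hp
  have e : p - c - act L μ = act (L * regr S L) (comp u i - c - act L μ) := by rw [hp]; abel
  have hpon : OnPath (multivariateGaussian μ S) γ p := by
    rw [onPath_gaussian_iff hS L μ c hγ, e, act_act, mul_regr_idem]
  have hB := isBayes_gaussian hS L μ c hγ g t u p hpon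
  rw [e, act_act, regr_mul_mul_regr] at hB
  refine ⟨⟨p, hpon, (nearest_iff hS L μ c hγ _ p hpon).2 hp, hB⟩,
    nextBelief_eq ⟨p, hpon, (nearest_iff hS L μ c hγ _ p hpon).2 hp, hB⟩ ?_⟩
  rintro π'' _ ⟨v, hv, hnear, hb⟩
  have hvp : v = p := (nearest_iff hS L μ c hγ _ v hv).1 hnear
  subst hvp
  exact isBayes_unique hb hB

theorem bayesOrPredict_updatesTo (g : Game n m) (t : ℕ) (u : Idx m → ℝ)
    (h : IsUnit (L * S * Lᵀ) ∨ L * S * Lᵀ = 0) :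
    UpdatesTo g g.bayesOrPredict t S L μ c γ u := by
  by_cases hon : OnPath (multivariateGaussian μ S) γ (comp u i)
  · have hB := isBayes_gaussian hS L μ c hγ g t u _ hon
    refine ⟨Or.inl ⟨hon, hB⟩, nextBelief_eq (Or.inl ⟨hon, hB⟩) ?_⟩
    rintro π'' _ (⟨_, hb⟩ | ⟨hn, _⟩)
    · exact isBayes_unique hb hB
    · exact absurd hon hn
  · rcases h with h | h
    -- For an invertible action covariance the projection is the identity, so no action is off path.
    · refine absurd ?_ hon
      rw [onPath_gaussian_iff hS L μ c hγ]
      have h1 : (1 - L * regr S L) = 0 := by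
        have := one_sub_mul_regr_mul S L
        exact (h.mul_left_eq_zero).1 this
      have h2 : act (1 - L * regr S L) (comp u i - c - act L μ) = 0 := by
        rw [h1]; ext; simp [act]
      rw [sub_act, one_act, sub_eq_zero] at h2
      exact h2.symm
    -- An almost surely constant action carries no information: the regression vanishes and the
    -- update is the prediction.
    · have hr : regr S L = 0 := by rw [regr, h, pinv_zero, Matrix.mul_zero]
      have hP : g.predict t i (multivariateGaussian μ S) u =
          multivariateGaussian (updMean g t S L μ c u)
            (g.A t i * resid S L * (g.A t i)ᵀ + g.Q i) := by
        have e := map_linear_multivariateGaussian hS (g.Q_posSemidef i) (g.A t i) μ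
          (WithLp.toLp 2 (g.B t i *ᵥ u))
        have e1 : resid S L = S := by simp [resid, hr]
        have e2 : updMean g t S L μ c u = WithLp.toLp 2 (g.B t i *ᵥ u) + act (g.A t i) μ := by
          have : act (0 : Matrix (Fin (n i)) (Fin (m i)) ℝ) (comp u i - c - act L μ) = 0 := by
            ext; simp [act]
          rw [updMean, hr, this, add_zero]
        rw [e1, e2, ← e]
        simp only [Game.predict, dyn_eq, Game.noise]
      refine ⟨Or.inr ⟨hon, hP.symm⟩, nextBelief_eq (Or.inr ⟨hon, hP.symm⟩) ?_⟩
      rintro π'' _ (⟨hn, _⟩ | ⟨_, hb⟩)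
      · exact absurd hn hon
      · rw [hb, hP]

end Update

/-! ### Minimization of an expected quadratic cost -/

section Quadratic

variable {y k : Type*} [Fintype y] [Fintype k]

theorem quad_eq_sum (W : Matrix y y ℝ) (v : y → ℝ) :
    quad W v = ∑ p, ∑ q, W p q * (v p * v q) := by
  simp only [quad, dotProduct, mulVec, Finset.mul_sum]
  exact Finset.sum_congr rfl fun p _ => Finset.sum_congr rfl fun q _ => by ring

theorem continuous_quad (W : Matrix y y ℝ) : Continuous (quad W) := by
  unfold quad
  fun_prop

theorem continuous_quad_ofLp (W : Matrix y y ℝ) :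
    Continuous fun x : EuclideanSpace ℝ y => quad W x.ofLp :=
  (continuous_quad W).comp (by fun_prop)

theorem dotProduct_mulVec_comm {W : Matrix y y ℝ} (hW : Wᵀ = W) (v w : y → ℝ) :
    v ⬝ᵥ W *ᵥ w = w ⬝ᵥ W *ᵥ v := by
  rw [dotProduct_mulVec, ← mulVec_transpose, hW, dotProduct_comm]

theorem transpose_congr_eq {W : Matrix y y ℝ} (hW : Wᵀ = W) {k : Type*} (D : Matrix y k ℝ) :
    (Dᵀ * W * D)ᵀ = Dᵀ * W * D := by
  simp only [transpose_mul, transpose_transpose, hW, Matrix.mul_assoc]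

theorem quad_add {W : Matrix y y ℝ} (hW : Wᵀ = W) (v w : y → ℝ) :
    quad W (v + w) = quad W v + 2 * (w ⬝ᵥ W *ᵥ v) + quad W w := by
  simp only [quad, mulVec_add, dotProduct_add, add_dotProduct]
  rw [dotProduct_mulVec_comm hW v w]
  ring

theorem quad_mulVec (W : Matrix y y ℝ) (D : Matrix y k ℝ) (u : k → ℝ) :
    quad W (D *ᵥ u) = quad (Dᵀ * W * D) u := by
  simp only [quad, ← mulVec_mulVec]
  rw [dotProduct_mulVec u, vecMul_transpose]

theorem PosSemidef.quad_nonneg {W : Matrix y y ℝ} (hW : W.PosSemidef) (v : y → ℝ) :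
    0 ≤ quad W v := by
  simpa [quad] using hW.dotProduct_mulVec_nonneg v

/-- A stationary point minimizes a convex quadratic function. -/
theorem quad_stationary_le {W : Matrix y y ℝ} (hW : Wᵀ = W) {D : Matrix y k ℝ}
    (hD : (Dᵀ * W * D).PosSemidef) {v : y → ℝ} (hv : Dᵀ *ᵥ (W *ᵥ v) = 0) (u : k → ℝ) :
    quad W v ≤ quad W (v + D *ᵥ u) := by
  have h1 : (D *ᵥ u) ⬝ᵥ W *ᵥ v = 0 := by
    rw [dotProduct_comm, dotProduct_mulVec, ← mulVec_transpose, hv, zero_dotProduct]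
  rw [quad_add hW, h1, quad_mulVec]
  have := PosSemidef.quad_nonneg hD u
  linarith

/-- The minimum of a strictly convex quadratic function, as a quadratic form in the offset. -/
theorem quad_schur_le [DecidableEq k] {W : Matrix y y ℝ} (hW : Wᵀ = W) {D : Matrix y k ℝ}
    (hD : (Dᵀ * W * D).PosDef) (v : y → ℝ) (u : k → ℝ) :
    quad W (v + D *ᵥ (-((Dᵀ * W * D)⁻¹ *ᵥ (Dᵀ *ᵥ (W *ᵥ v))))) ≤ quad W (v + D *ᵥ u) := by
  set u₀ := -((Dᵀ * W * D)⁻¹ *ᵥ (Dᵀ *ᵥ (W *ᵥ v))) with hu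
  have h0 : Dᵀ *ᵥ (W *ᵥ (v + D *ᵥ u₀)) = 0 := by
    have hdet : IsUnit (Dᵀ * W * D).det := hD.isUnit.map Matrix.detMonoidHom
    have e : Dᵀ *ᵥ (W *ᵥ (D *ᵥ u₀)) = (Dᵀ * W * D) *ᵥ u₀ := by
      simp only [mulVec_mulVec, Matrix.mul_assoc]
    have e' : ∀ z, (Dᵀ * W * D) *ᵥ ((Dᵀ * W * D)⁻¹ *ᵥ z) = z := fun z => by
      rw [mulVec_mulVec, mul_nonsing_inv _ hdet, one_mulVec]
    rw [mulVec_add, mulVec_add, e, hu, mulVec_neg, e', add_neg_cancel]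
  have := quad_stationary_le hW hD.posSemidef h0 (u - u₀)
  rwa [add_assoc, ← mulVec_add, add_sub_cancel] at this

variable [DecidableEq y]

theorem integrable_mul_multivariateGaussian (μ : EuclideanSpace ℝ y) (K : Matrix y y ℝ)
    (p q : y) : Integrable (fun x => x p * x q) (multivariateGaussian μ K) := by
  have h : ∀ p : y, MemLp (fun x : EuclideanSpace ℝ y => x p) 2 (multivariateGaussian μ K) :=
    fun p => (EuclideanSpace.proj (𝕜 := ℝ) p).comp_memLp' IsGaussian.memLp_two_id
  exact (h p).integrable_mul (h q)

theorem integral_mul_multivariateGaussian (μ : EuclideanSpace ℝ y) {K : Matrix y y ℝ}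
    (hK : K.PosSemidef) (p q : y) :
    ∫ x, x p * x q ∂(multivariateGaussian μ K) = K p q + μ p * μ q := by
  have h : ∀ p : y, MemLp (fun x : EuclideanSpace ℝ y => x p) 2 (multivariateGaussian μ K) :=
    fun p => (EuclideanSpace.proj (𝕜 := ℝ) p).comp_memLp' IsGaussian.memLp_two_id
  have hm : ∀ p : y, ∫ x, x p ∂(multivariateGaussian μ K) = μ p := by
    intro p
    have := (EuclideanSpace.proj (𝕜 := ℝ) p).integral_comp_comm
      (μ := multivariateGaussian μ K) IsGaussian.integrable_fun_id
    simpa using this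
  have h1 := covariance_eval_multivariateGaussian (μ := μ) hK p q
  rw [covariance_eq_sub (h p) (h q), hm, hm] at h1
  simp only [Pi.mul_apply] at h1
  linarith

theorem integrable_quad_multivariateGaussian (W : Matrix y y ℝ) (μ : EuclideanSpace ℝ y)
    (K : Matrix y y ℝ) : Integrable (fun x => quad W x.ofLp) (multivariateGaussian μ K) := by
  simp only [quad_eq_sum]
  exact integrable_finsetSum _ fun p _ => integrable_finsetSum _ fun q _ =>
    (integrable_mul_multivariateGaussian μ K p q).const_mul _

theorem integral_quad_multivariateGaussian (W : Matrix y y ℝ) (μ : EuclideanSpace ℝ y)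
    {K : Matrix y y ℝ} (hK : K.PosSemidef) :
    ∫ x, quad W x.ofLp ∂(multivariateGaussian μ K) = quad W μ.ofLp + (K * W).trace := by
  have hi := fun p q => (integrable_mul_multivariateGaussian μ K p q).const_mul (W p q)
  have hs : ∀ p q, K q p = K p q := fun p q => congrFun (congrFun (PosSemidef.transpose_eq hK) p) q
  calc ∫ x, quad W x.ofLp ∂(multivariateGaussian μ K)
      = ∫ x, ∑ p, ∑ q, W p q * (x p * x q) ∂(multivariateGaussian μ K) := by
        simp only [quad_eq_sum]
    _ = ∑ p, ∑ q, W p q * (K p q + μ p * μ q) := by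
        refine (integral_finsetSum _ fun p _ => integrable_finsetSum _ fun q _ => hi p q).trans
          (Finset.sum_congr rfl fun p _ => (integral_finsetSum _ fun q _ => hi p q).trans
            (Finset.sum_congr rfl fun q _ => ?_))
        rw [integral_const_mul, integral_mul_multivariateGaussian μ hK]
    _ = quad W μ.ofLp + (K * W).trace := by
        simp only [quad_eq_sum, mul_add, Finset.sum_add_distrib, Matrix.trace, Matrix.diag,
          Matrix.mul_apply]
        rw [add_comm]
        congr 1
        rw [Finset.sum_comm]
        exact Finset.sum_congr rfl fun q _ => Finset.sum_congr rfl fun p _ => by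
          rw [hs, mul_comm]

theorem map_const_add_multivariateGaussian {K : Matrix y y ℝ} (hK : K.PosSemidef)
    (v : EuclideanSpace ℝ y) :
    (multivariateGaussian 0 K).map (fun x => v + x) = multivariateGaussian v K := by
  have := map_affine_multivariateGaussian hK 0 1 v
  simpa [one_act] using this

theorem integrable_quad_add (W : Matrix y y ℝ) {K : Matrix y y ℝ} (hK : K.PosSemidef)
    (v : y → ℝ) :
    Integrable (fun x : EuclideanSpace ℝ y => quad W (v + x.ofLp)) (multivariateGaussian 0 K) := by
  have h := integrable_quad_multivariateGaussian W (WithLp.toLp 2 v) K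
  rw [← map_const_add_multivariateGaussian hK] at h
  exact h.comp_measurable (by fun_prop)

theorem integral_quad_add (W : Matrix y y ℝ) {K : Matrix y y ℝ} (hK : K.PosSemidef)
    (v : y → ℝ) :
    ∫ x : EuclideanSpace ℝ y, quad W (v + x.ofLp) ∂(multivariateGaussian 0 K) =
      quad W v + (K * W).trace := by
  have h := integral_quad_multivariateGaussian W (WithLp.toLp 2 v) hK
  rw [← map_const_add_multivariateGaussian hK, integral_map (by fun_prop)
    (continuous_quad_ofLp W).aestronglyMeasurable] at h
  exact h

end Quadratic

/-! ### Extended expectations of quadratic costs -/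

section ExtExp

theorem extExp_map {Ω Ω' : Type*} [MeasurableSpace Ω] [MeasurableSpace Ω'] {μ : Measure Ω}
    {e : Ω → Ω'} (he : Measurable e) {f : Ω' → ℝ} (hf : Measurable f) :
    extExp (μ.map e) f = extExp μ (f ∘ e) := by
  unfold extExp
  have h1 := integrable_map_measure (μ := μ) (f := e) (g := f) hf.aestronglyMeasurable
    he.aemeasurable
  have hg : Measurable fun ω => max (-f ω) 0 := by fun_prop
  have h2 := integrable_map_measure (μ := μ) (f := e) hg.aestronglyMeasurable he.aemeasurable
  rw [integral_map he.aemeasurable hf.aestronglyMeasurable]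
  by_cases hi : Integrable f (μ.map e)
  · rw [if_pos hi, if_pos (h1.1 hi)]
    rfl
  · rw [if_neg hi, if_neg (mt h1.2 hi)]
    by_cases hj : Integrable (fun ω => max (-f ω) 0) (μ.map e)
    · rw [if_pos hj, if_pos (by exact h2.1 hj)]
    · rw [if_neg hj, if_neg (by exact mt h2.2 hj)]

variable {y k : Type*} [Fintype y] [Fintype k] [DecidableEq y] {W : Matrix y y ℝ}
  {D : Matrix y k ℝ} {K : Matrix y y ℝ} (a : y → ℝ) (r : ℝ)

/-- A quadratic cost with an action, an offset and a noise. -/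
def quadCost (W : Matrix y y ℝ) (D : Matrix y k ℝ) (a : y → ℝ) (r : ℝ)
    (p : EuclideanSpace ℝ k × EuclideanSpace ℝ y) : ℝ :=
  quad W (a + D *ᵥ p.1.ofLp + p.2.ofLp) + r

omit [DecidableEq y] in
theorem continuous_quadCost : Continuous (quadCost W D a r) :=
  ((continuous_quad W).comp (by fun_prop)).add continuous_const

/-- The expected cost of a deterministic action. -/
theorem extExp_quadCost_dirac (hK : K.PosSemidef) (u₀ : EuclideanSpace ℝ k) :
    extExp ((Measure.dirac u₀).prod (multivariateGaussian 0 K)) (quadCost W D a r) =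
      ((quad W (a + D *ᵥ u₀.ofLp) + (K * W).trace + r : ℝ) : EReal) := by
  have hm := (continuous_quadCost (W := W) (D := D) a r).measurable
  have hi := (integrable_quad_add W hK (a + D *ᵥ u₀.ofLp)).add (integrable_const r)
  rw [Measure.dirac_prod, extExp_map (by fun_prop) hm, extExp, if_pos (by exact hi)]
  congr 1
  have := integral_add (integrable_quad_add W hK (a + D *ᵥ u₀.ofLp)) (integrable_const r)
  rw [integral_quad_add W hK, integral_const, probReal_univ, one_smul] at this
  exact this

/-- No randomized action has a smaller expected cost than a stationary one. -/
theorem le_extExp_quadCost [DecidableEq k] (hW : Wᵀ = W) (hD : (Dᵀ * W * D).PosDef)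
    (hK : K.PosSemidef) (u₀ : EuclideanSpace ℝ k)
    (hu₀ : Dᵀ *ᵥ (W *ᵥ (a + D *ᵥ u₀.ofLp)) = 0) (ν : Measure (EuclideanSpace ℝ k))
    [IsProbabilityMeasure ν] :
    ((quad W (a + D *ᵥ u₀.ofLp) + (K * W).trace + r : ℝ) : EReal) ≤
      extExp (ν.prod (multivariateGaussian 0 K)) (quadCost W D a r) := by
  have hm := (continuous_quadCost (W := W) (D := D) a r)
  unfold extExp
  split_ifs with h1 h2
  · rw [EReal.coe_le_coe_iff, integral_prod _ h1]
    have hin : ∀ u : EuclideanSpace ℝ k,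
        ∫ x, quadCost W D a r (u, x) ∂(multivariateGaussian 0 K) =
          quad W (a + D *ᵥ u.ofLp) + (K * W).trace + r := by
      intro u
      have := integral_add (integrable_quad_add W hK (a + D *ᵥ u.ofLp)) (integrable_const r)
      rw [integral_quad_add W hK, integral_const, probReal_univ, one_smul] at this
      exact this
    have hle : ∀ u : EuclideanSpace ℝ k, quad W (a + D *ᵥ u₀.ofLp) + (K * W).trace + r ≤
        ∫ x, quadCost W D a r (u, x) ∂(multivariateGaussian 0 K) := by
      intro u
      have := quad_stationary_le hW hD.posSemidef hu₀ (u.ofLp - u₀.ofLp)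
      rw [add_assoc, ← mulVec_add, add_sub_cancel] at this
      rw [hin]
      linarith
    calc _ = ∫ _, (quad W (a + D *ᵥ u₀.ofLp) + (K * W).trace + r) ∂ν := by simp
      _ ≤ _ := integral_mono (integrable_const _) h1.integral_prod_left hle
  · exact le_top
  -- The value `-∞` is impossible: minimizing over the action for each noise value bounds the cost
  -- below by an integrable function.
  · refine absurd ?_ h2
    set N : Matrix y y ℝ := 1 - D * (Dᵀ * W * D)⁻¹ * Dᵀ * W with hN
    have hNv : ∀ v : y → ℝ, v + D *ᵥ (-((Dᵀ * W * D)⁻¹ *ᵥ (Dᵀ *ᵥ (W *ᵥ v)))) = N *ᵥ v := by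
      intro v
      simp only [hN, sub_mulVec, one_mulVec, mulVec_neg, ← mulVec_mulVec]
      rw [sub_eq_add_neg]
    -- The bound is quadratic in the noise alone, so it is integrable whatever the moments of `ν`.
    have hlow : ∀ p : EuclideanSpace ℝ k × EuclideanSpace ℝ y,
        quad (Nᵀ * W * N) (a + p.2.ofLp) + r ≤ quadCost W D a r p := by
      intro p
      have := quad_schur_le hW hD (a + p.2.ofLp) p.1.ofLp
      rw [hNv, quad_mulVec] at this
      rw [quadCost, add_right_comm]
      linarith
    have hi : Integrable (fun p : EuclideanSpace ℝ k × EuclideanSpace ℝ y =>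
        quad (Nᵀ * W * N) (a + p.2.ofLp) + r) (ν.prod (multivariateGaussian 0 K)) :=
      ((integrable_quad_add (Nᵀ * W * N) hK a).add (integrable_const r)).comp_snd ν
    refine hi.mono (by fun_prop) (ae_of_all _ fun p => ?_)
    rw [Real.norm_eq_abs, Real.norm_eq_abs, abs_of_nonneg (le_max_right _ _)]
    refine max_le ?_ (abs_nonneg _)
    have := neg_abs_le (quad (Nᵀ * W * N) (a + p.2.ofLp) + r)
    linarith [hlow p]

end ExtExp

/-! ### Joint vectors -/

section Joint

variable {d d' : Fin 2 → ℕ}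

theorem other_ne (i : Fin 2) : other i ≠ i := by
  fin_cases i <;> decide

theorem eq_other_of_ne {i j : Fin 2} (h : j ≠ i) : j = other i := by
  fin_cases i <;> fin_cases j <;> first | rfl | exact absurd rfl h

@[simp] theorem inj_mulVec_same (i : Fin 2) (v : Fin (d i) → ℝ) (b : Fin (d i)) :
    (inj d i *ᵥ v) ⟨i, b⟩ = v b := by
  simp [inj, mulVec, dotProduct]

theorem inj_mulVec_ne {i j : Fin 2} (h : j ≠ i) (v : Fin (d i) → ℝ) (b : Fin (d j)) :
    (inj d i *ᵥ v) ⟨j, b⟩ = 0 := by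
  simp [inj, mulVec, dotProduct, h]

theorem inj_transpose_mulVec (i : Fin 2) (v : Idx d → ℝ) :
    (inj d i)ᵀ *ᵥ v = (comp v i).ofLp := by
  ext b
  simp [inj, comp, mulVec, dotProduct]

theorem oth_mulVec (i : Fin 2) (v : Idx d → ℝ) :
    oth d i *ᵥ v = inj d (other i) *ᵥ (comp v (other i)).ofLp := by
  ext ⟨j, b⟩
  rw [oth, mulVec_diagonal]
  by_cases h : j = i
  · subst h
    rw [inj_mulVec_ne (other_ne j).symm]
    simp
  · obtain rfl := eq_other_of_ne h
    rw [inj_mulVec_same]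
    simp [h, comp]

theorem own_add_oth (i : Fin 2) : own d i + oth d i = 1 := by
  ext p q
  by_cases h : p = q
  · subst h
    by_cases h' : p.1 = i <;> simp [own, oth, h']
  · simp [own, oth, h]

theorem blockDiagonal'_mulVec (M : ∀ j, Matrix (Fin (d' j)) (Fin (d j)) ℝ) (v : Idx d → ℝ) :
    blockDiagonal' M *ᵥ v = flat fun j => act (M j) (comp v j) := by
  ext ⟨j, b⟩
  simp only [mulVec, dotProduct, Fintype.sum_sigma, flat, ofLp_act]
  rw [Finset.sum_eq_single j]
  · simp [comp]
  · intro k _ hk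
    exact Finset.sum_eq_zero fun c _ => by rw [blockDiagonal'_apply_ne _ _ _ hk.symm, zero_mul]
  · simp

@[simp] theorem comp_flat (v : ∀ j, Sp d j) (j : Fin 2) : comp (flat v) j = v j := rfl

theorem comp_add (v w : Idx d → ℝ) (j : Fin 2) : comp (v + w) j = comp v j + comp w j := rfl

theorem comp_sub (v w : Idx d → ℝ) (j : Fin 2) : comp (v - w) j = comp v j - comp w j := rfl

@[fun_prop] theorem continuous_comp (j : Fin 2) :
    Continuous fun v : Idx d → ℝ => comp v j := by
  unfold comp
  fun_prop

end Joint

/-! ### The cost variables and their covariance -/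

namespace Game

variable (g : Game n m)

theorem quad_Vbar (i : Fin 2) (W : Matrix (EIdx n i) (EIdx n i) ℝ) (U : Idx m → ℝ)
    (X : Idx n → ℝ) (e : EIdx n i → ℝ) :
    quad (g.Vbar i W) (Sum.elim (Sum.elim U X) e) = g.stageCost i X U + quad W e := by
  simp only [Vbar, costR, quad, stageCost, fromBlocks_mulVec, Sum.elim_comp_inl,
    Sum.elim_comp_inr, zero_mulVec, add_zero, zero_add, dotProduct, Fintype.sum_sum_type,
    Sum.elim_inl, Sum.elim_inr]
  have h : ∑ p, X p * ((g.costS i)ᵀ *ᵥ U) p = ∑ p, U p * (g.costS i *ᵥ X) p := by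
    change X ⬝ᵥ _ = U ⬝ᵥ _
    rw [dotProduct_mulVec, vecMul_transpose, dotProduct_comm]
  simp only [Pi.add_apply, mul_add, Finset.sum_add_distrib, h]
  ring

/-- The means of the updated beliefs. -/
def updMeans (t : ℕ) (Sg : Cov n) (L : Gain n m) (μ : ∀ j, Sp n j) (c U : Idx m → ℝ) :
    ∀ j, Sp n j :=
  fun j => updMean g t (Sg j) (L j) (μ j) (comp c j) U

theorem flat_updMeans (t : ℕ) (Sg : Cov n) (L : Gain n m) (μ : ∀ j, Sp n j) (c U : Idx m → ℝ) :
    flat (g.updMeans t Sg L μ c U) = g.fullB t *ᵥ U + blockDiagonal' (g.A t) *ᵥ flat μ +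
      g.fullAG t Sg L *ᵥ (U - c - blockDiagonal' L *ᵥ flat μ) := by
  rw [fullAG, blockDiagonal'_mulVec, blockDiagonal'_mulVec, blockDiagonal'_mulVec]
  ext ⟨j, b⟩
  simp only [updMeans, updMean, flat, comp_sub, ← act_act, act_add, Pi.add_apply,
    PiLp.add_apply, ← add_assoc]
  rfl

/-- The selector of the noise coordinates, which are those of the next type. -/
def noiseSel (n m : Fin 2 → ℕ) (i : Fin 2) : Matrix (YIdx n m i) (Fin (n i)) ℝ :=
  Matrix.fromRows 0 (Matrix.fromRows 1 0)

/-- All the variables in the cost of player `i` are affine in the own action, in the deviation of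
the other player's type from its mean, and in the noise. -/
theorem allVars_eq (t : ℕ) (Sg : Cov n) (L : Gain n m) (i : Fin 2) (μ : ∀ j, Sp n j)
    (c : Idx m → ℝ) (x : Sp n i) (u : Sp m i) (ξ : Sp n (other i)) (w : Sp n i) :
    let X : Idx n → ℝ := assemble i x (μ (other i) + ξ)
    let U : Idx m → ℝ := assemble i u (act (L (other i)) (μ (other i) + ξ) + comp c (other i))
    Sum.elim (Sum.elim U X) (evec i (g.dyn t i x U w) (g.updMeans t Sg L μ c U)) =
      (g.Dx t i *ᵥ x.ofLp + g.Dxhat t Sg L i *ᵥ flat μ + g.Cm t Sg L i *ᵥ c) +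
        g.Du t Sg L i *ᵥ u.ofLp + (g.Jm t Sg L i *ᵥ ξ.ofLp + noiseSel n m i *ᵥ w.ofLp) := by
  intro X U
  have hU : U = inj m i *ᵥ u.ofLp + oth m i *ᵥ (blockDiagonal' L *ᵥ flat μ + c) +
      inj m (other i) *ᵥ (L (other i) *ᵥ ξ.ofLp) := by
    rw [oth_mulVec, blockDiagonal'_mulVec, comp_add, comp_flat, comp_flat, add_assoc,
      ← mulVec_add]
    simp only [U, assemble, act_add]
    congr 2
    ext b
    simp only [PiLp.add_apply, Pi.add_apply, ofLp_act]
    ring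
  have hX : X = inj n i *ᵥ x.ofLp + oth n i *ᵥ flat μ + inj n (other i) *ᵥ ξ.ofLp := by
    rw [oth_mulVec, comp_flat, add_assoc, ← mulVec_add]
    rfl
  -- The innovation. The other player's part is the image of `ξ`; the own part compares `u` with the
  -- action prescribed at the mean type, since beliefs are updated with the prescribed strategy even
  -- after a deviation.
  have hd : U - c - blockDiagonal' L *ᵥ flat μ = inj m i *ᵥ u.ofLp +
      inj m (other i) *ᵥ (L (other i) *ᵥ ξ.ofLp) -
        own m i *ᵥ (blockDiagonal' L *ᵥ flat μ + c) := by
    have := congrArg (· *ᵥ (blockDiagonal' L *ᵥ flat μ + c)) (own_add_oth (d := m) i)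
    simp only [add_mulVec, one_mulVec] at this
    rw [hU, eq_sub_of_add_eq' this]
    abel
  have hD : (g.dyn t i x U w).ofLp = g.A t i *ᵥ x.ofLp + g.B t i *ᵥ U + w.ofLp := rfl
  rw [evec, flat_updMeans, hd, hD, hX, hU]
  funext p
  rcases p with (p | p) | (p | p) <;>
    simp only [Du, Dx, Dxhat, Cm, Jm, noiseSel, fromRows_mulVec, Pi.add_apply, Sum.elim_inl,
      Sum.elim_inr, zero_mulVec, one_mulVec, Pi.zero_apply, ← mulVec_mulVec, mulVec_add,
      mulVec_sub, add_mulVec, sub_mulVec, Pi.sub_apply] <;>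
    ring

/-- The covariance of the random part of the variables in the cost of player `i`. -/
def randCov (t : ℕ) (Sg : Cov n) (L : Gain n m) (i : Fin 2) :
    Matrix (YIdx n m i) (YIdx n m i) ℝ :=
  g.Jm t Sg L i * Sg (other i) * (g.Jm t Sg L i)ᵀ + noiseSel n m i * g.Q i * (noiseSel n m i)ᵀ

theorem randCov_posSemidef (t : ℕ) {Sg : Cov n} (hS : ∀ j, (Sg j).PosSemidef) (L : Gain n m)
    (i : Fin 2) : (g.randCov t Sg L i).PosSemidef :=
  (posSemidef_sandwich (hS _) _).add (posSemidef_sandwich (g.Q_posSemidef i) _)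

/-- Cyclicity of the trace, together with the fact that the noise enters only the next own type.
This matches the increment of `ρ`. -/
theorem trace_randCov (t : ℕ) (Sg : Cov n) (L : Gain n m) (i : Fin 2)
    (W : Matrix (EIdx n i) (EIdx n i) ℝ) :
    (g.randCov t Sg L i * g.Vbar i W).trace =
      (Sg (other i) * ((g.Jm t Sg L i)ᵀ * g.Vbar i W * g.Jm t Sg L i)).trace +
        (g.Q i * W.toBlocks₁₁).trace := by
  have hN : (noiseSel n m i)ᵀ * g.Vbar i W * noiseSel n m i = W.toBlocks₁₁ := by
    conv_lhs => rw [← fromBlocks_toBlocks W]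
    rw [noiseSel, Vbar, Matrix.mul_assoc, fromBlocks_mul_fromRows, fromBlocks_mul_fromRows,
      transpose_fromRows, transpose_fromRows, fromCols_mul_fromRows]
    simp [fromCols_mul_fromRows]
  have key : ∀ {q : Type} [Fintype q] (M : Matrix (YIdx n m i) q ℝ) (R : Matrix q q ℝ)
      (V : Matrix (YIdx n m i) (YIdx n m i) ℝ),
      (M * R * Mᵀ * V).trace = (R * (Mᵀ * V * M)).trace := by
    intro q _ M R V
    rw [Matrix.mul_assoc, Matrix.mul_assoc, trace_mul_comm]
    simp only [Matrix.mul_assoc]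
  rw [randCov, Matrix.add_mul, trace_add, key, key, hN]

end Game

/-! ### The cost-to-go as an expected quadratic cost -/

namespace Game

variable (g : Game n m)

instance isProbabilityMeasure_noise (i : Fin 2) : IsProbabilityMeasure (g.noise i) := by
  unfold noise
  infer_instance

theorem map_randVec (t : ℕ) {Sg : Cov n} (hS : ∀ j, (Sg j).PosSemidef) (L : Gain n m)
    (i : Fin 2) :
    ((multivariateGaussian 0 (Sg (other i))).prod (g.noise i)).map
      (fun p => act (g.Jm t Sg L i) p.1 + act (noiseSel n m i) p.2) =
      multivariateGaussian 0 (g.randCov t Sg L i) := by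
  have h1 := map_affine_multivariateGaussian (hS (other i)) 0 (g.Jm t Sg L i) 0
  have h2 := map_affine_multivariateGaussian (g.Q_posSemidef i) 0 (noiseSel n m i) 0
  have h := map_add_multivariateGaussian (posSemidef_sandwich (hS (other i)) (g.Jm t Sg L i))
    (posSemidef_sandwich (g.Q_posSemidef i) (noiseSel n m i)) 0 0
  simp only [act_zero, zero_add] at h1 h2 h
  rw [← h1, ← h2, Measure.map_prod_map _ _ (by fun_prop) (by fun_prop),
    Measure.map_map (by fun_prop) (by fun_prop)] at h
  exact h

/-- Reordering the product shows that the own action is independent of the pooled Gaussian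
disturbance. -/
theorem map_actionRandVec (t : ℕ) {Sg : Cov n} (hS : ∀ j, (Sg j).PosSemidef) (L : Gain n m)
    (i : Fin 2) (ν : Measure (Sp m i)) [IsProbabilityMeasure ν] :
    (((multivariateGaussian 0 (Sg (other i))).prod ν).prod (g.noise i)).map
      (fun p => (p.1.2, act (g.Jm t Sg L i) p.1.1 + act (noiseSel n m i) p.2)) =
      ν.prod (multivariateGaussian 0 (g.randCov t Sg L i)) := by
  have hψ : Measurable fun p : Sp n (other i) × Sp n i =>
      act (g.Jm t Sg L i) p.1 + act (noiseSel n m i) p.2 := by fun_prop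
  have h1 := Measure.map_prod_map (ν.prod (multivariateGaussian 0 (Sg (other i)))) (g.noise i)
    measurable_swap measurable_id
  have h2 := Measure.map_prod_map ν ((multivariateGaussian 0 (Sg (other i))).prod (g.noise i))
    measurable_id hψ
  rw [Measure.prod_swap, Measure.map_id] at h1
  rw [g.map_randVec t hS L i, Measure.map_id, ← Measure.prodAssoc_prod,
    Measure.map_map (by fun_prop) (by fun_prop)] at h2
  rw [h1, h2, Measure.map_map (by fun_prop) (by fun_prop)]
  rfl

theorem continuous_updMeans (t : ℕ) (Sg : Cov n) (L : Gain n m) (μ : ∀ j, Sp n j)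
    (c : Idx m → ℝ) : Continuous fun U => flat (g.updMeans t Sg L μ c U) := by
  simp only [flat_updMeans]
  fun_prop

/-- The cost-to-go if the other player uses an affine strategy, and the next value is quadratic on
the updated Gaussian beliefs. -/
theorem costToGo_eq {upd : UpdateRule n m} {Vnext : ∀ i : Fin 2, Belief n → Sp n i → ℝ} {t : ℕ}
    {Sg : Cov n} (hS : ∀ j, (Sg j).PosSemidef) (L : Gain n m) (μ : ∀ j, Sp n j) (c : Idx m → ℝ)
    {γ : Partial n m} (hγ : ∀ j x, γ j x = Measure.dirac (act (L j) x + comp c j))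
    (hupd : ∀ U, nextBeliefs upd t (gaussBelief μ Sg) γ U =
      gaussBelief (g.updMeans t Sg L μ c U) (g.phiS t Sg L))
    (i : Fin 2) (W : Matrix (EIdx n i) (EIdx n i) ℝ) (r : ℝ)
    (hV : ∀ (xhat : ∀ j, Sp n j) (x : Sp n i),
      Vnext i (gaussBelief xhat (g.phiS t Sg L)) x = quad W (evec i x xhat) + r)
    (x : Sp n i) (ν : Measure (Sp m i)) [IsProbabilityMeasure ν] :
    g.costToGo upd Vnext t (gaussBelief μ Sg) γ i x ν =
      extExp (ν.prod (multivariateGaussian 0 (g.randCov t Sg L i)))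
        (quadCost (g.Vbar i W) (g.Du t Sg L i)
          (g.Dx t i *ᵥ x.ofLp + g.Dxhat t Sg L i *ᵥ flat μ + g.Cm t Sg L i *ᵥ c) r) := by
  set o := other i with ho
  have hfm : Measurable fun x => act (L o) x + comp c o := by fun_prop
  have hdet : γ o = Kernel.deterministic (fun x => act (L o) x + comp c o) hfm := by
    ext1 x
    rw [hγ, Kernel.deterministic_apply]
  have hh : Measurable fun ξ : Sp n o => (μ o + ξ, act (L o) (μ o + ξ) + comp c o) := by
    fun_prop
  have hπ : (gaussBelief μ Sg o) ⊗ₘ (γ o) = (multivariateGaussian 0 (Sg o)).map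
      fun ξ => (μ o + ξ, act (L o) (μ o + ξ) + comp c o) := by
    rw [hdet, gaussBelief, Measure.compProd_deterministic,
      ← map_const_add_multivariateGaussian (hS o), Measure.map_map (by fun_prop) (by fun_prop)]
    rfl
  -- The other player's type and action are both functions of one centred deviation, which becomes
  -- the integration variable.
  have hM : (((gaussBelief μ Sg o) ⊗ₘ (γ o)).prod ν).prod (g.noise i) =
      (((multivariateGaussian 0 (Sg o)).prod ν).prod (g.noise i)).map
        (Prod.map (Prod.map (fun ξ => (μ o + ξ, act (L o) (μ o + ξ) + comp c o)) id) id) := by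
    rw [hπ, ← Measure.map_prod_map _ _ (hh.prodMap measurable_id) measurable_id,
      ← Measure.map_prod_map _ _ hh measurable_id, Measure.map_id, Measure.map_id]
  set a := g.Dx t i *ᵥ x.ofLp + g.Dxhat t Sg L i *ᵥ flat μ + g.Cm t Sg L i *ᵥ c with ha
  let Y : ((Sp n o × Sp m o) × Sp m i) × Sp n i → YIdx n m i → ℝ := fun ω =>
    Sum.elim (Sum.elim (assemble i ω.1.2 ω.1.1.2) (assemble i x ω.1.1.1))
      (evec i (g.dyn t i x (assemble i ω.1.2 ω.1.1.2) ω.2)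
        (g.updMeans t Sg L μ c (assemble i ω.1.2 ω.1.1.2)))
  have hY : Continuous Y := by
    have hU : Continuous fun ω : ((Sp n o × Sp m o) × Sp m i) × Sp n i =>
        assemble i ω.1.2 ω.1.1.2 := by
      unfold assemble
      fun_prop
    have hX : Continuous fun ω : ((Sp n o × Sp m o) × Sp m i) × Sp n i =>
        assemble i x ω.1.1.1 := by
      unfold assemble
      fun_prop
    have hD : Continuous fun ω : ((Sp n o × Sp m o) × Sp m i) × Sp n i =>
        (g.dyn t i x (assemble i ω.1.2 ω.1.1.2) ω.2).ofLp := by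
      simp only [dyn]
      fun_prop
    refine continuous_pi fun p => ?_
    rcases p with (p | p) | (p | p)
    · exact (continuous_apply p).comp hU
    · exact (continuous_apply p).comp hX
    · exact (continuous_apply p).comp hD
    · exact (continuous_apply p).comp ((g.continuous_updMeans t Sg L μ c).comp hU)
  have hcost : g.costToGo upd Vnext t (gaussBelief μ Sg) γ i x ν =
      extExp ((((gaussBelief μ Sg o) ⊗ₘ (γ o)).prod ν).prod (g.noise i))
        fun ω => quad (g.Vbar i W) (Y ω) + r := by
    unfold costToGo
    congr 1
    funext ω
    simp only [Y, quad_Vbar, hupd, hV]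
    ring
  have hYm : Measurable fun ω => quad (g.Vbar i W) (Y ω) + r :=
    (((continuous_quad _).comp hY).add continuous_const).measurable
  rw [hcost, hM, extExp_map ((hh.prodMap measurable_id).prodMap measurable_id) hYm,
    ← g.map_actionRandVec t hS L i ν, extExp_map (by fun_prop) (continuous_quadCost _ _).measurable]
  congr 1
  funext ω
  have := g.allVars_eq t Sg L i μ c x ω.1.2 ω.1.1 ω.2
  simp only [Function.comp_apply, Prod.map_fst, Prod.map_snd, id_eq, quadCost, Y]
  rw [this]
  rfl

end Game

/-! ### The value matrices -/

namespace Game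

variable (g : Game n m)

theorem costR_transpose (i : Fin 2) : (g.costR i)ᵀ = g.costR i := by
  rw [costR, fromBlocks_transpose, transpose_transpose, g.costT_symm i, g.costP_symm i]

theorem Vbar_transpose (i : Fin 2) {W : Matrix (EIdx n i) (EIdx n i) ℝ} (hW : Wᵀ = W) :
    (g.Vbar i W)ᵀ = g.Vbar i W := by
  rw [Vbar, fromBlocks_transpose, costR_transpose, hW, transpose_zero, transpose_zero]

theorem valMatAux_transpose (L : ℕ → Cov n → Gain n m) (k : ℕ) :
    ∀ (Sg : Cov n) (i : Fin 2), (g.valMatAux L k Sg i)ᵀ = g.valMatAux L k Sg i := by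
  induction k with
  | zero => intro Sg i; exact transpose_zero
  | succ k ih =>
    intro Sg i
    exact transpose_congr_eq (g.Vbar_transpose i (ih _ i)) _

theorem Vbar_posSemidef (i : Fin 2) {W : Matrix (EIdx n i) (EIdx n i) ℝ}
    (hR : (g.costR i).PosSemidef) (hW : W.PosSemidef) : (g.Vbar i W).PosSemidef := by
  refine PosSemidef.of_dotProduct_mulVec_nonneg ?_ fun v => ?_
  · rw [IsHermitian, conjTranspose_eq_transpose_of_trivial]
    exact g.Vbar_transpose i (PosSemidef.transpose_eq hW)
  · have h1 := hR.dotProduct_mulVec_nonneg (v ∘ Sum.inl)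
    have h2 := hW.dotProduct_mulVec_nonneg (v ∘ Sum.inr)
    simp only [star_trivial] at h1 h2 ⊢
    have e : v ⬝ᵥ g.Vbar i W *ᵥ v =
        (v ∘ Sum.inl) ⬝ᵥ g.costR i *ᵥ (v ∘ Sum.inl) + (v ∘ Sum.inr) ⬝ᵥ W *ᵥ (v ∘ Sum.inr) := by
      simp only [Vbar, fromBlocks_mulVec, zero_mulVec, add_zero, zero_add, dotProduct,
        Fintype.sum_sum_type, Sum.elim_inl, Sum.elim_inr, Function.comp_apply]
    rw [e]
    exact add_nonneg h1 h2

theorem valMatAux_posSemidef (hR : ∀ i, (g.costR i).PosSemidef) (L : ℕ → Cov n → Gain n m)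
    (k : ℕ) : ∀ (Sg : Cov n) (i : Fin 2), (g.valMatAux L k Sg i).PosSemidef := by
  induction k with
  | zero => intro Sg i; exact PosSemidef.zero
  | succ k ih =>
    intro Sg i
    have := posSemidef_sandwich (g.Vbar_posSemidef i (hR i) (ih
      (g.phiS (g.horizon - k) Sg (L (g.horizon - k) Sg)) i))
      (g.Ft (g.horizon - k) Sg (L (g.horizon - k) Sg)
        (g.valMatAux L k (g.phiS (g.horizon - k) Sg (L (g.horizon - k) Sg))) i)ᵀ
    rwa [transpose_transpose] at this

/-- Positive definite costs make the problems of the players strictly convex. -/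
theorem hessianPosDef_of_costR (hR : ∀ i, (g.costR i).PosDef) (L : ℕ → Cov n → Gain n m) (t : ℕ)
    (Sg : Cov n) : g.HessianPosDef L t Sg := by
  intro i
  have hW : (g.nextValMat L t Sg i).PosSemidef :=
    g.valMatAux_posSemidef (fun i => (hR i).posSemidef) L _ _ i
  have hV := g.Vbar_posSemidef i (hR i).posSemidef hW
  refine PosDef.of_dotProduct_mulVec_pos ?_ fun {u} hu => ?_
  · rw [IsHermitian, conjTranspose_eq_transpose_of_trivial]
    exact transpose_congr_eq (PosSemidef.transpose_eq hV) _
  · rw [star_trivial]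
    change 0 < quad _ u
    have e : g.Du t Sg (L t Sg) i *ᵥ u = Sum.elim (Sum.elim (inj m i *ᵥ u) 0)
        (fromRows (g.B t i * inj m i) ((g.fullAG t Sg (L t Sg) + g.fullB t) * inj m i) *ᵥ u) := by
      rw [Du, fromRows_mulVec, fromRows_mulVec, zero_mulVec]
    have e2 : quad (g.Vbar i (g.nextValMat L t Sg i)) (g.Du t Sg (L t Sg) i *ᵥ u) =
        quad (g.costR i) (Sum.elim (inj m i *ᵥ u) 0) + quad (g.nextValMat L t Sg i)
        (fromRows (g.B t i * inj m i) ((g.fullAG t Sg (L t Sg) + g.fullB t) * inj m i) *ᵥ u) := by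
      rw [e]
      simp only [quad, Vbar, fromBlocks_mulVec, Sum.elim_comp_inl, Sum.elim_comp_inr, zero_mulVec,
        add_zero, zero_add, dotProduct, Fintype.sum_sum_type, Sum.elim_inl, Sum.elim_inr]
    rw [← quad_mulVec, e2]
    -- The action itself is a coordinate of the stage cost, so the stage cost alone gives strict
    -- positivity.
    have h1 : 0 < quad (g.costR i) (Sum.elim (inj m i *ᵥ u) 0) := by
      have hne : (Sum.elim (inj m i *ᵥ u) 0 : Idx m ⊕ Idx n → ℝ) ≠ 0 := by
        intro h0
        refine hu (funext fun b => ?_)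
        have := congrFun h0 (Sum.inl ⟨i, b⟩)
        simpa using this
      simpa [quad] using (hR i).dotProduct_mulVec_pos hne
    have h2 := PosSemidef.quad_nonneg hW
      (fromRows (g.B t i * inj m i) ((g.fullAG t Sg (L t Sg) + g.fullB t) * inj m i) *ᵥ u)
    linarith

/-- The first-order condition for both players. -/
theorem Du_transpose_mul_Ft {L : ℕ → Cov n → Gain n m} {t : ℕ} {Sg : Cov n}
    (hgain : g.GainEquation L t Sg) (hoff : g.OffsetSolvable L t Sg) (i : Fin 2) :
    (g.Du t Sg (L t Sg) i)ᵀ * g.Vbar i (g.nextValMat L t Sg i) *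
      g.Ft t Sg (L t Sg) (g.nextValMat L t Sg) i = 0 := by
  set W := g.nextValMat L t Sg with hWdef
  have h1 : (g.Du t Sg (L t Sg) i)ᵀ * g.Vbar i (W i) *
      (g.Du t Sg (L t Sg) i * L t Sg i + g.Dx t i) = 0 := by
    rw [Matrix.mul_add, ← Matrix.mul_assoc, hgain i, hWdef, neg_add_cancel]
  -- The pseudo-inverse yields a solution as soon as there is one, since `K K⁺ K M = K M`.
  have h2 : g.mLhs t Sg (L t Sg) W * g.Mt t Sg (L t Sg) W = -g.mRhs t Sg (L t Sg) W := by
    obtain ⟨M, hM⟩ := hoff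
    have hR : g.mRhs t Sg (L t Sg) W = -(g.mLhs t Sg (L t Sg) W * M) := by rw [hM, neg_neg]
    rw [Mt, hR, Matrix.mul_neg, Matrix.mul_neg, Matrix.mul_neg, neg_neg, neg_neg, ← Matrix.mul_assoc,
      ← Matrix.mul_assoc, (isPinv_pinv _).1]
  have h3 : (g.Du t Sg (L t Sg) i)ᵀ * g.Vbar i (W i) *
      (g.Du t Sg (L t Sg) i * ((inj m i)ᵀ * g.Mt t Sg (L t Sg) W) +
        g.Cm t Sg (L t Sg) i * g.Mt t Sg (L t Sg) W + g.Dxhat t Sg (L t Sg) i) = 0 := by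
    have h4 : (g.Du t Sg (L t Sg) i)ᵀ * g.Vbar i (W i) *
        (g.Du t Sg (L t Sg) i * (inj m i)ᵀ + g.Cm t Sg (L t Sg) i) * g.Mt t Sg (L t Sg) W =
        -((g.Du t Sg (L t Sg) i)ᵀ * g.Vbar i (W i) * g.Dxhat t Sg (L t Sg) i) := by
      ext b q
      exact congrFun (congrFun h2 ⟨i, b⟩) q
    rw [← Matrix.mul_assoc (g.Du t Sg (L t Sg) i), ← Matrix.add_mul, Matrix.mul_add,
      ← Matrix.mul_assoc _ _ (g.Mt t Sg (L t Sg) W), h4, neg_add_cancel]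
  rw [Ft, mul_fromCols, h1, h3]
  ext b (q | q) <;> rfl

end Game

/-! ### The solution of the backward recursion -/

/-- The means of a pair of beliefs. -/
def meanOf (π : Belief n) : ∀ j, Sp n j := fun j => ∫ x, x ∂(π j)

/-- The covariance matrices of a pair of beliefs. -/
def covOf (π : Belief n) : Cov n :=
  fun j => Matrix.of fun a b => cov[fun x => x a, fun x => x b; π j]

theorem meanOf_gaussBelief (xhat : ∀ j, Sp n j) (Sg : Cov n) :
    meanOf (gaussBelief xhat Sg) = xhat :=
  funext fun _ => integral_id_multivariateGaussian

/-- Strategies and values must be functions of beliefs as measures; recovering the parameters from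
moments makes them so. -/
theorem covOf_gaussBelief (xhat : ∀ j, Sp n j) {Sg : Cov n} (hS : ∀ j, (Sg j).PosSemidef) :
    covOf (gaussBelief xhat Sg) = Sg := by
  funext j
  ext a b
  exact covariance_eval_multivariateGaussian (hS j) a b

namespace Game

variable (g : Game n m) (L : ℕ → Cov n → Gain n m)

theorem linAction_eq (t : ℕ) (Sg : Cov n) (xhat : ∀ j, Sp n j) (i : Fin 2) (x : Sp n i) :
    g.linAction L t Sg xhat i x =
      act (L t Sg i) x + comp (g.offsetMat L t Sg *ᵥ flat xhat) i := rfl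

theorem measurable_linAction (t : ℕ) (Sg : Cov n) (xhat : ∀ j, Sp n j) (i : Fin 2) :
    Measurable (g.linAction L t Sg xhat i) := by
  simp only [funext (g.linAction_eq L t Sg xhat i)]
  fun_prop

/-- The strategies of the linear solution. -/
def linStrategy (t : ℕ) (π : Belief n) : Partial n m := fun i =>
  Kernel.deterministic (g.linAction L t (covOf π) (meanOf π) i)
    (g.measurable_linAction L t (covOf π) (meanOf π) i)

/-- The values of the linear solution. -/
def quadValue (t : ℕ) (i : Fin 2) (π : Belief n) (x : Sp n i) : ℝ :=
  quad (g.valMat L t (covOf π) i) (evec i x (meanOf π)) + g.rho L t (covOf π) i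

theorem linStrategy_gaussBelief (t : ℕ) (xhat : ∀ j, Sp n j) {Sg : Cov n}
    (hS : ∀ j, (Sg j).PosSemidef) (i : Fin 2) (x : Sp n i) :
    g.linStrategy L t (gaussBelief xhat Sg) i x =
      Measure.dirac (g.linAction L t Sg xhat i x) := by
  rw [linStrategy, Kernel.deterministic_apply, covOf_gaussBelief xhat hS, meanOf_gaussBelief]

theorem quadValue_gaussBelief (t : ℕ) (xhat : ∀ j, Sp n j) {Sg : Cov n}
    (hS : ∀ j, (Sg j).PosSemidef) (i : Fin 2) (x : Sp n i) :
    g.quadValue L t i (gaussBelief xhat Sg) x =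
      quad (g.valMat L t Sg i) (evec i x xhat) + g.rho L t Sg i := by
  rw [quadValue, covOf_gaussBelief xhat hS, meanOf_gaussBelief]

theorem quadValue_terminal (i : Fin 2) (π : Belief n) (x : Sp n i) :
    g.quadValue L (g.horizon + 1) i π x = 0 := by
  simp [quadValue, valMat, rho, valMatAux, rhoAux, quad]

theorem valMat_eq {t : ℕ} (ht : t ≤ g.horizon) (Sg : Cov n) (i : Fin 2) :
    g.valMat L t Sg i = (g.Ft t Sg (L t Sg) (g.nextValMat L t Sg) i)ᵀ *
      g.Vbar i (g.nextValMat L t Sg i) * g.Ft t Sg (L t Sg) (g.nextValMat L t Sg) i := by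
  obtain ⟨k, hk⟩ := Nat.exists_eq_add_of_le ht
  -- The auxiliary recursion counts stages to go; `t ≤ horizon` keeps these natural subtractions
  -- from truncating.
  have e1 : g.horizon + 1 - t = k + 1 := by omega
  have e2 : g.horizon + 1 - (t + 1) = k := by omega
  have e3 : g.horizon - k = t := by omega
  have hW : g.nextValMat L t Sg = g.valMatAux L k (g.phiS t Sg (L t Sg)) := by
    funext j
    rw [nextValMat, valMat, e2]
  rw [valMat, e1, hW]
  simp only [valMatAux, e3]

theorem rho_eq {t : ℕ} (ht : t ≤ g.horizon) (Sg : Cov n) (i : Fin 2) :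
    g.rho L t Sg i = (g.randCov t Sg (L t Sg) i * g.Vbar i (g.nextValMat L t Sg i)).trace +
      g.rho L (t + 1) (g.phiS t Sg (L t Sg)) i := by
  obtain ⟨k, hk⟩ := Nat.exists_eq_add_of_le ht
  have e1 : g.horizon + 1 - t = k + 1 := by omega
  have e2 : g.horizon + 1 - (t + 1) = k := by omega
  have e3 : g.horizon - k = t := by omega
  rw [trace_randCov, rho, rho, e1, e2]
  simp only [rhoAux, e3]

/-- `F̃ e` is the vector of cost variables at the prescribed action with the disturbance set to
zero. This links the value recursion to the minimization. -/
theorem Ft_mulVec_evec (t : ℕ) (Sg : Cov n) (xhat : ∀ j, Sp n j) (i : Fin 2) (x : Sp n i) :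
    g.Ft t Sg (L t Sg) (g.nextValMat L t Sg) i *ᵥ evec i x xhat =
      (g.Dx t i *ᵥ x.ofLp + g.Dxhat t Sg (L t Sg) i *ᵥ flat xhat +
        g.Cm t Sg (L t Sg) i *ᵥ (g.offsetMat L t Sg *ᵥ flat xhat)) +
        g.Du t Sg (L t Sg) i *ᵥ (g.linAction L t Sg xhat i x).ofLp := by
  rw [Ft, evec, fromCols_mulVec_sumElim, linAction_eq, WithLp.ofLp_add, ← inj_transpose_mulVec,
    offsetMat]
  simp only [ofLp_act, mulVec_add, add_mulVec, ← mulVec_mulVec]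
  abel

/-- The linear strategies and quadratic values solve the backward recursion under every update rule
that maps Gaussian beliefs to the Gaussian beliefs with the regression means. -/
theorem isBackwardSolution_of_updatesTo {upd : UpdateRule n m} {𝒮 : ℕ → Set (Cov n)}
    (h𝒮_psd : ∀ t, ∀ Sg ∈ 𝒮 t, ∀ i, (Sg i).PosSemidef)
    (h𝒮_closed : ∀ t, 1 ≤ t → t ≤ g.horizon → ∀ Sg ∈ 𝒮 t, g.phiS t Sg (L t Sg) ∈ 𝒮 (t + 1))
    (hgain : ∀ t, 1 ≤ t → t ≤ g.horizon → ∀ Sg ∈ 𝒮 t, g.GainEquation L t Sg)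
    (hpos : ∀ t, 1 ≤ t → t ≤ g.horizon → ∀ Sg ∈ 𝒮 t, g.HessianPosDef L t Sg)
    (hoff : ∀ t, 1 ≤ t → t ≤ g.horizon → ∀ Sg ∈ 𝒮 t, g.OffsetSolvable L t Sg)
    (hupd : ∀ t, 1 ≤ t → t ≤ g.horizon → ∀ Sg ∈ 𝒮 t, ∀ (i : Fin 2) (μ : Sp n i) (c : Sp m i)
      (γ : Kernel (Sp n i) (Sp m i)), (∀ x, γ x = Measure.dirac (act (L t Sg i) x + c)) →
      ∀ u, UpdatesTo g upd t (Sg i) (L t Sg i) μ c γ u) :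
    g.IsBackwardSolution upd (gaussBeliefs 𝒮) (g.linStrategy L) (g.quadValue L) := by
  have hstrat : ∀ t, ∀ Sg ∈ 𝒮 t, ∀ (xhat : ∀ j, Sp n j) (j : Fin 2) (x : Sp n j),
      g.linStrategy L t (gaussBelief xhat Sg) j x =
        Measure.dirac (act (L t Sg j) x + comp (g.offsetMat L t Sg *ᵥ flat xhat) j) :=
    fun t Sg hSg xhat j x => g.linStrategy_gaussBelief L t xhat (h𝒮_psd t Sg hSg) j x
  have hnext : ∀ t, 1 ≤ t → t ≤ g.horizon → ∀ Sg ∈ 𝒮 t, ∀ (xhat : ∀ j, Sp n j) (U : Idx m → ℝ),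
      nextBeliefs upd t (gaussBelief xhat Sg) (g.linStrategy L t (gaussBelief xhat Sg)) U =
        gaussBelief (g.updMeans t Sg (L t Sg) xhat (g.offsetMat L t Sg *ᵥ flat xhat) U)
          (g.phiS t Sg (L t Sg)) := by
    intro t h1 h2 Sg hSg xhat U
    funext j
    refine (hupd t h1 h2 Sg hSg j (xhat j) _ _ (hstrat t Sg hSg xhat j) U).2.trans ?_
    simp only [gaussBelief, updMeans, phiS, resid, regr, gainG, Matrix.mul_assoc]
  have hcost : ∀ t, 1 ≤ t → t ≤ g.horizon → ∀ Sg ∈ 𝒮 t, ∀ (xhat : ∀ j, Sp n j) (i : Fin 2)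
      (x : Sp n i) (ν : Measure (Sp m i)), IsProbabilityMeasure ν →
      g.costToGo upd (g.quadValue L (t + 1)) t (gaussBelief xhat Sg)
        (g.linStrategy L t (gaussBelief xhat Sg)) i x ν =
      extExp (ν.prod (multivariateGaussian 0 (g.randCov t Sg (L t Sg) i)))
        (quadCost (g.Vbar i (g.nextValMat L t Sg i)) (g.Du t Sg (L t Sg) i)
          (g.Dx t i *ᵥ x.ofLp + g.Dxhat t Sg (L t Sg) i *ᵥ flat xhat +
            g.Cm t Sg (L t Sg) i *ᵥ (g.offsetMat L t Sg *ᵥ flat xhat))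
          (g.rho L (t + 1) (g.phiS t Sg (L t Sg)) i)) := by
    intro t h1 h2 Sg hSg xhat i x ν _
    -- The next covariance stays in the class, hence is positive semidefinite, so the next value has
    -- its quadratic form.
    exact g.costToGo_eq (h𝒮_psd t Sg hSg) (L t Sg) xhat _ (hstrat t Sg hSg xhat)
      (hnext t h1 h2 Sg hSg xhat) i _ _ (fun xhat' x' => g.quadValue_gaussBelief L (t + 1) xhat'
        (h𝒮_psd _ _ (h𝒮_closed t h1 h2 Sg hSg)) i x') x ν
  have hval : ∀ t, 1 ≤ t → t ≤ g.horizon → ∀ Sg ∈ 𝒮 t, ∀ (xhat : ∀ j, Sp n j) (i : Fin 2)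
      (x : Sp n i), g.quadValue L t i (gaussBelief xhat Sg) x =
      quad (g.Vbar i (g.nextValMat L t Sg i)) ((g.Dx t i *ᵥ x.ofLp +
        g.Dxhat t Sg (L t Sg) i *ᵥ flat xhat +
        g.Cm t Sg (L t Sg) i *ᵥ (g.offsetMat L t Sg *ᵥ flat xhat)) +
        g.Du t Sg (L t Sg) i *ᵥ (g.linAction L t Sg xhat i x).ofLp) +
      (g.randCov t Sg (L t Sg) i * g.Vbar i (g.nextValMat L t Sg i)).trace +
      g.rho L (t + 1) (g.phiS t Sg (L t Sg)) i := by
    intro t h1 h2 Sg hSg xhat i x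
    rw [g.quadValue_gaussBelief L t xhat (h𝒮_psd t Sg hSg), g.valMat_eq L h2, g.rho_eq L h2,
      ← quad_mulVec, Ft_mulVec_evec]
    ring
  have hvalue : ∀ t, 1 ≤ t → t ≤ g.horizon → ∀ Sg ∈ 𝒮 t, ∀ (xhat : ∀ j, Sp n j) (i : Fin 2)
      (x : Sp n i), ((g.quadValue L t i (gaussBelief xhat Sg) x : ℝ) : EReal) =
      g.costToGo upd (g.quadValue L (t + 1)) t (gaussBelief xhat Sg)
        (g.linStrategy L t (gaussBelief xhat Sg)) i x
        (g.linStrategy L t (gaussBelief xhat Sg) i x) := by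
    intro t h1 h2 Sg hSg xhat i x
    rw [g.linStrategy_gaussBelief L t xhat (h𝒮_psd t Sg hSg),
      hcost t h1 h2 Sg hSg xhat i x _ inferInstance,
      extExp_quadCost_dirac _ _ (g.randCov_posSemidef t (h𝒮_psd t Sg hSg) _ i),
      hval t h1 h2 Sg hSg]
  refine ⟨g.quadValue_terminal L, ?_, ?_, ?_, ?_⟩
  · intro t _ _ π _ i
    unfold linStrategy
    infer_instance
  · rintro t h1 h2 _ ⟨xhat, Sg, hSg, rfl⟩ u
    refine ⟨fun i => ?_, ?_⟩
    · have h := hupd t h1 h2 Sg hSg i (xhat i) _ _ (hstrat t Sg hSg xhat i) u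
      have h' := h.1
      rw [← h.2] at h'
      exact h'
    · rw [hnext t h1 h2 Sg hSg]
      exact ⟨_, _, h𝒮_closed t h1 h2 Sg hSg, rfl⟩
  · rintro t h1 h2 _ ⟨xhat, Sg, hSg, rfl⟩ i x ν hν
    rw [← hvalue t h1 h2 Sg hSg, hcost t h1 h2 Sg hSg xhat i x ν hν, hval t h1 h2 Sg hSg]
    refine le_extExp_quadCost _ _ (g.Vbar_transpose i (g.valMatAux_transpose L _ _ i))
      (hpos t h1 h2 Sg hSg i) (g.randCov_posSemidef t (h𝒮_psd t Sg hSg) _ i) _ ?_ ν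
    -- Stationarity of the prescribed action is the first-order matrix identity applied to `e`.
    rw [← Ft_mulVec_evec, mulVec_mulVec, mulVec_mulVec]
    exact (congrArg (· *ᵥ evec i x xhat) (g.Du_transpose_mul_Ft (hgain t h1 h2 Sg hSg)
      (hoff t h1 h2 Sg hSg) i)).trans (zero_mulVec _)
  · rintro t h1 h2 _ ⟨xhat, Sg, hSg, rfl⟩ i x
    exact hvalue t h1 h2 Sg hSg xhat i x

end Game

end LQG

end

/-! ### The theorem for both off-path rules -/

theorem mainTheorem2 {n m : Fin 2 → ℕ} (g : LQG.Game n m)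
    (𝒮 : ℕ → Set (LQG.Cov n)) (L : ℕ → LQG.Cov n → LQG.Gain n m)
    (h𝒮_psd : ∀ t, ∀ Sg ∈ 𝒮 t, ∀ i, (Sg i).PosSemidef)
    (h𝒮_closed : ∀ t, 1 ≤ t → t ≤ g.horizon → ∀ Sg ∈ 𝒮 t, g.phiS t Sg (L t Sg) ∈ 𝒮 (t + 1))
    (hgain : ∀ t, 1 ≤ t → t ≤ g.horizon → ∀ Sg ∈ 𝒮 t, g.GainEquation L t Sg)
    (hpos : (∀ i, (g.costR i).PosDef) ∨
      ∀ t, 1 ≤ t → t ≤ g.horizon → ∀ Sg ∈ 𝒮 t, g.HessianPosDef L t Sg)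
    (hoff : ∀ t, 1 ≤ t → t ≤ g.horizon → ∀ Sg ∈ 𝒮 t, g.OffsetSolvable L t Sg) :
    ∃ (θ : ℕ → LQG.Belief n → LQG.Partial n m)
      (V : ℕ → ∀ i : Fin 2, LQG.Belief n → LQG.Sp n i → ℝ),
      g.IsBackwardSolution g.bayesOrNearest (LQG.gaussBeliefs 𝒮) θ V ∧
      ((∀ t, 1 ≤ t → t ≤ g.horizon → ∀ Sg ∈ 𝒮 t, ∀ i,
          IsUnit (L t Sg i * Sg i * (L t Sg i)ᵀ) ∨ L t Sg i * Sg i * (L t Sg i)ᵀ = 0) →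
        g.IsBackwardSolution g.bayesOrPredict (LQG.gaussBeliefs 𝒮) θ V) ∧
      (∀ t, 1 ≤ t → t ≤ g.horizon → ∀ Sg ∈ 𝒮 t, ∀ (xhat : ∀ j, LQG.Sp n j) (i : Fin 2)
        (x : LQG.Sp n i),
        θ t (LQG.gaussBelief xhat Sg) i x = Measure.dirac (g.linAction L t Sg xhat i x)) ∧
      (∀ t, 1 ≤ t → t ≤ g.horizon + 1 → ∀ Sg ∈ 𝒮 t, ∀ (xhat : ∀ j, LQG.Sp n j) (i : Fin 2)
        (x : LQG.Sp n i),
        V t i (LQG.gaussBelief xhat Sg) x =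
          LQG.quad (g.valMat L t Sg i) (LQG.evec i x xhat) + g.rho L t Sg i) := by
  have hpos' : ∀ t, 1 ≤ t → t ≤ g.horizon → ∀ Sg ∈ 𝒮 t, g.HessianPosDef L t Sg := by
    rcases hpos with h | h
    · exact fun t _ _ Sg _ => g.hessianPosDef_of_costR h L t Sg
    · exact h
  refine ⟨g.linStrategy L, g.quadValue L, ?_, fun hL => ?_, ?_, ?_⟩
  · exact g.isBackwardSolution_of_updatesTo L h𝒮_psd h𝒮_closed hgain hpos' hoff
      fun t _ _ Sg hSg i μ c γ hγ u =>
        LQG.bayesOrNearest_updatesTo (h𝒮_psd t Sg hSg i) _ μ c hγ g t u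
  · exact g.isBackwardSolution_of_updatesTo L h𝒮_psd h𝒮_closed hgain hpos' hoff
      fun t h1 h2 Sg hSg i μ c γ hγ u =>
        LQG.bayesOrPredict_updatesTo (h𝒮_psd t Sg hSg i) _ μ c hγ g t u (hL t h1 h2 Sg hSg i)
  · exact fun t _ _ Sg hSg xhat i x =>
      g.linStrategy_gaussBelief L t xhat (h𝒮_psd t Sg hSg) i x
  · exact fun t _ _ Sg hSg xhat i x =>
      g.quadValue_gaussBelief L t xhat (h𝒮_psd t Sg hSg) i x
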